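/- **Setting.** Consider a two-player zero-sum game with payoff matrices $A^{(ij)}\in\mathbb R^{n_i\times n_j}$, $A^{(ij)}=-(A^{(ji)})^{\top}$, with nonempty closed convex strategy sets $\mathcal X_i\subseteq\mathbb R^{n_i}$ and lower semicontinuous, strongly convex regularizers $h_i:\mathcal X_i\to\mathbb R$; let $h_i^*(y)=\max_{x\in\mathcal X_i}\{\langle x,y\rangle-h_i(x)\}$. Fix a player $i$ with opponent $j$, a vector $y_j(0)\in\mathbb R^{n_j}$, and a time $t_0>0$. In continuous FTRL, from time $t_0$ on, the cumulative strategy $X_i$ and cumulative payoff $y_i$ of player $i$ satisfy $$X_i(t)=X_i(t_0)+\int_{t_0}^t x_i(s)\,ds,\qquad y_i(t)=y_i(t_0)+\int_{t_0}^t A^{(ij)}x_j(s)\,ds,$$ $$x_i(t)=\operatorname*{argmax}_{x\in\mathcal X_i}\{\langle x,y_i(t)\rangle-h_i(x)\},\qquad x_j(t)=\operatorname*{argmax}_{x\in\mathcal X_j}\{\langle x,\,y_j(0)+A^{(ji)}X_i(t)\rangle-h_j(x)\}.$$ Let $\phi_t:\mathbb R^{2n_i}\to\mathbb R^{2n_i}$,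 $t\ge t_0$, be the flow, started at time $t_0$, of Hamilton's equations $\dot X_i=\partial H/\partial y_i$, $\dot y_i=-\partial H/\partial X_i$ with $H(X_i,y_i)=h_i^*(y_i)+h_j^*(y_j(0)+A^{(ji)}X_i)$. The initial condition $Z=(X_i(t_0),y_i(t_0))$ is a random vector in $\mathbb R^{2n_i}$ with finite variances, mean $m$ and covariance matrix $P(t_0)$; $\Delta$ denotes standard deviation and $\sigma^2=\operatorname{tr}P(t_0)=\mathbb E\|Z-m\|^2$. For a set $S\subset\mathbb R^{2n}$ the linear Gromov (symplectic) width is $$w_L(S)=\sup\{\pi r^2:\ r>0,\ \psi(B^{2n}(r))\subseteq S\ \text{for some affine symplectomorphism }\psi\},$$ where $B^{2n}(r)$ is the closed ball of radius $r$ and $\sup\emptyset=0$. For a covariance matrix $P$, $w_L(P)$ denotes the width of the ellipsoid $\{Pw:\ w^{\top}Pw\le1\}$, which is $\{x:\ x^{\top}P^{-1}x\le 1\}$ when $P$ is invertible. For $c>0$ and a function $\tau$ with $\tau(R)\to0$ as $R\to\infty$, say that $Z$ has *shape* $(c,\tau)$ if $$w_L(P(t_0))\ge c\,\sigma^2\ \text{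 or }\ w_L(P(t_0))=0,\qquad\text{and}\qquad \mathbb E\big[\|Z-m\|^2\,;\,\|Z-m\|>R\sigma\big]\le\tau(R)\,\sigma^2\ \text{ for all } R>0.$$ (Every square-integrable $Z$ has some shape, and the shape is unchanged when $Z$ is translated or rescaled.) **Theorem (Heisenberg-type inequality).** Let $I\subseteq(t_0,\infty)$ be a set of times and $K$ a constant such that, for all $t\in I$, $\phi_t$ is twice continuously differentiable with $\|D^2\phi_t\|\le K$ everywhere. Suppose that $I$ is bounded, or that also $\|D\phi_t\|\le K$ everywhere for all $t\in I$. (In particular $I$ may be a single time $t>t_0$; and if the differentials of orders one and two are bounded by $K$ uniformly in $t>t_0$, then $I=(t_0,\infty)$ is allowed.) Then for every $c>0$ and every $\tau$ with $\tau(R)\to0$ as $R\to\infty$ there is $\delta>0$ such that the following holds. If the initial random vector has shape $(c,\tau)$, and $\Delta X_{i,\alpha}(t_0)<\delta$ and $\Delta y_{i,\alpha}(t_0)<\delta$ for all $\alpha\in[n_i]$, and $(X_i(t),y_i(t))$ evolves by continuous FTRL almost surely, then for all $t\in I$ and all $\alpha\in[n_i]$ the variables $X_{i,\alpha}(t)$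 and $y_{i,\alpha}(t)$ have finite variance and $$\Delta X_{i,\alpha}(t)\,\Delta y_{i,\alpha}(t)\ \ge\ \frac{1}{\sqrt2}\,\frac{w_L(P(t_0))}{\pi}.$$ -/

import Mathlib

open MeasureTheory ProbabilityTheory Filter Topology

noncomputable section

/-- The phase space `ℝ^{2n}` with its Euclidean norm; `Sum.inl α` is the position coordinate `X_α`,
`Sum.inr α` the conjugate momentum coordinate `y_α`. -/
abbrev Phase (n : ℕ) : Type := EuclideanSpace ℝ (Fin n ⊕ Fin n)

/-- The point `(X, y)` of phase space. -/
def Phase.mk {n : ℕ} (X y : EuclideanSpace ℝ (Fin n)) : Phase n :=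
  WithLp.toLp 2 (Sum.elim (fun α => X α) (fun α => y α))

/-- The position part `X` of a point `(X, y)`. -/
def Phase.pos {n : ℕ} (z : Phase n) : EuclideanSpace ℝ (Fin n) :=
  WithLp.toLp 2 (fun α => z (Sum.inl α))

/-- The momentum part `y` of a point `(X, y)`. -/
def Phase.mom {n : ℕ} (z : Phase n) : EuclideanSpace ℝ (Fin n) :=
  WithLp.toLp 2 (fun α => z (Sum.inr α))

/-! ### Hamiltonian systems -/

/-- The Hamiltonian vector field `(∂H/∂y, -∂H/∂X)`. -/
def hamiltonianField {n : ℕ} (H : Phase n → ℝ) (z : Phase n) : Phase n :=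
  WithLp.toLp 2 (Sum.elim
    (fun α => fderiv ℝ H z (EuclideanSpace.single (Sum.inr α) 1))
    (fun α => -fderiv ℝ H z (EuclideanSpace.single (Sum.inl α) 1)))

/-- `φ t z` is, for `t ≥ t₀`, the value at time `t` of the solution of Hamilton's equations for `H`
that starts in `z` at time `t₀`. -/
def IsHamiltonianFlow {n : ℕ} (H : Phase n → ℝ) (t₀ : ℝ) (φ : ℝ → Phase n → Phase n) : Prop :=
  ∀ z, φ t₀ z = z ∧ ∀ t, t₀ ≤ t →
    HasDerivWithinAt (fun s => φ s z) (hamiltonianField H (φ t z)) (Set.Ici t₀) t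

/-! ### Two-player zero-sum games and continuous-time FTRL -/

/-- A two-player zero-sum game with payoff matrices `A^{(ij)}`, strategy sets `𝒳ᵢ ⊆ ℝ^{nᵢ}` and
regularizers `hᵢ`; the players are `0` and `1`, and the opponent of `i` is `1 - i`. -/
structure RegularizedGame where
  /-- number of actions of each player -/
  n : Fin 2 → ℕ
  /-- payoff matrices; only those with `i ≠ j` have a meaning -/
  payoff : ∀ i j : Fin 2, Matrix (Fin (n i)) (Fin (n j)) ℝ
  zeroSum : ∀ i j : Fin 2, i ≠ j → payoff i j = -(payoff j i).transpose
  /-- strategy sets -/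
  strategies : ∀ i, Set (EuclideanSpace ℝ (Fin (n i)))
  strategies_nonempty : ∀ i, (strategies i).Nonempty
  strategies_closed : ∀ i, IsClosed (strategies i)
  strategies_convex : ∀ i, Convex ℝ (strategies i)
  /-- regularizers; only their values on the strategy sets matter -/
  reg : ∀ i, EuclideanSpace ℝ (Fin (n i)) → ℝ
  reg_lsc : ∀ i, LowerSemicontinuousOn (reg i) (strategies i)
  reg_strongConvex : ∀ i, ∃ m : ℝ, 0 < m ∧ StrongConvexOn (strategies i) m (reg i)

namespace RegularizedGame

variable (G : RegularizedGame)

/-- The space `ℝ^{nᵢ}`. -/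
abbrev E (i : Fin 2) : Type := EuclideanSpace ℝ (Fin (G.n i))

/-- `x = argmax_{x ∈ 𝒳ᵢ} (⟨x, y⟩ - hᵢ(x))`. -/
def IsResponse (i : Fin 2) (y x : G.E i) : Prop :=
  x ∈ G.strategies i ∧ IsMaxOn (fun u => inner ℝ u y - G.reg i u) (G.strategies i) x

/-- The convex conjugate `hᵢ*(y) = max_{x ∈ 𝒳ᵢ} (⟨x, y⟩ - hᵢ(x))`. -/
def conj (i : Fin 2) (y : G.E i) : ℝ :=
  sSup ((fun x => inner ℝ x y - G.reg i x) '' G.strategies i)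

/-- The linear map `x ↦ A^{(ij)} x`. -/
def act (i j : Fin 2) (x : G.E j) : G.E i := (G.payoff i j).toEuclideanLin x

/-- The Hamiltonian `H(Xᵢ, yᵢ) = hᵢ*(yᵢ) + hⱼ*(yⱼ(0) + A^{(ji)} Xᵢ)` of player `i`, where `j = 1 - i`
and `v = yⱼ(0)`. -/
def hamiltonian (i : Fin 2) (v : G.E (1 - i)) (z : Phase (G.n i)) : ℝ :=
  G.conj i z.mom + G.conj (1 - i) (v + G.act (1 - i) i z.pos)

/-- `(X, y)` is, from time `t₀` on, the pair of cumulative strategy and cumulative payoff of player `i`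
in continuous-time FTRL, where `v = yⱼ(0)` and `j = 1 - i`: with `x` and `x'` the strategies of `i`
and of `j`, and with `yⱼ(t) = yⱼ(0) + A^{(ji)} Xᵢ(t)`. -/
def IsFTRL (i : Fin 2) (v : G.E (1 - i)) (t₀ : ℝ) (X y : ℝ → G.E i) : Prop :=
  ∃ (x : ℝ → G.E i) (x' : ℝ → G.E (1 - i)), ∀ t, t₀ ≤ t →
    IntervalIntegrable x volume t₀ t ∧ IntervalIntegrable x' volume t₀ t ∧
    G.IsResponse i (y t) (x t) ∧
    G.IsResponse (1 - i) (v + G.act (1 - i) i (X t)) (x' t) ∧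
    X t = X t₀ + ∫ s in t₀..t, x s ∧
    y t = y t₀ + ∫ s in t₀..t, G.act i (1 - i) (x' s)

end RegularizedGame

/-! ### Linear symplectic width -/

/-- The linear symplectic (Gromov) width of `A ⊆ ℝ^{2n}`: the supremum of `π r²` over the radii `r > 0`
for which some affine symplectomorphism `z ↦ S z + b` maps the closed ball of radius `r` into `A`.
(The supremum is that of a bounded set when `A` is bounded, and it is `0` if there is no such `r`.) -/
def linearSymplecticWidth {n : ℕ} (A : Set (Phase n)) : ℝ :=
  sSup {c : ℝ | ∃ r : ℝ, 0 < r ∧ c = Real.pi * r ^ 2 ∧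
    ∃ S ∈ Matrix.symplecticGroup (Fin n) ℝ, ∃ b : Phase n,
      (fun z : Phase n => S.toEuclideanLin z + b) '' Metric.closedBall 0 r ⊆ A}

/-- The ellipsoid of a positive semidefinite matrix `P`. For invertible `P` it is
`{x | xᵀ P⁻¹ x ≤ 1}` (put `w = P⁻¹ x`); for singular `P` it is a degenerate ellipsoid in the range of
`P`, namely the image of the unit ball under `P^{1/2}`. -/
def ellipsoid {ι : Type*} [Fintype ι] [DecidableEq ι] (P : Matrix ι ι ℝ) :
    Set (EuclideanSpace ℝ ι) :=
  {x | ∃ w : EuclideanSpace ℝ ι, x = P.toEuclideanLin w ∧ inner ℝ w (P.toEuclideanLin w) ≤ 1}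

/-! ### Random vectors -/

/-- The standard deviation `Δf`. -/
def stdDev {Ω : Type*} [MeasurableSpace Ω] (f : Ω → ℝ) (μ : Measure Ω) : ℝ :=
  Real.sqrt (Var[f; μ])

/-- The covariance matrix of a random vector. -/
def covMatrix {Ω ι : Type*} [MeasurableSpace Ω] (Z : Ω → EuclideanSpace ℝ ι) (μ : Measure Ω) :
    Matrix ι ι ℝ :=
  Matrix.of fun a b => cov[fun ω => Z ω a, fun ω => Z ω b; μ]

/-- The linear symplectic width `w_L(P)` of the ellipsoid of the covariance matrix `P` of `Z`. -/
def covWidth {Ω : Type*} [MeasurableSpace Ω] {n : ℕ} (Z : Ω → Phase n) (μ : Measure Ω) : ℝ :=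
  linearSymplecticWidth (ellipsoid (covMatrix Z μ))

/-- The square-integrable random vector `Z` has shape bounds `(c, τ)`. With `m` the mean, `P` the
covariance matrix and `σ² = tr P = 𝔼‖Z - m‖²` this says that `w_L(P) ≥ c σ²` unless `w_L(P) = 0`, and
that the tails `𝔼[‖Z - m‖² ; ‖Z - m‖ > R σ]` are at most `τ(R) σ²`. Both bounds are unchanged when
`Z` is translated or rescaled. -/
structure HasShape {Ω : Type*} [MeasurableSpace Ω] {n : ℕ} (Z : Ω → Phase n) (μ : Measure Ω)
    (c : ℝ) (τ : ℝ → ℝ) : Prop where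
  memLp : MemLp Z 2 μ
  width : 0 < covWidth Z μ → c * (covMatrix Z μ).trace ≤ covWidth Z μ
  tail : ∀ R : ℝ, 0 < R →
    ∫ ω in {ω | R * Real.sqrt (covMatrix Z μ).trace < ‖Z ω - ∫ ω', Z ω' ∂μ‖},
      ‖Z ω - ∫ ω', Z ω' ∂μ‖ ^ 2 ∂μ ≤ τ R * (covMatrix Z μ).trace

end

/-!
Write `ω(u, w) = ⟨J u, w⟩` for the symplectic form on phase space, and `ψ = φ_t`.

*Regularity.* Strong convexity of the regularizers makes the best responses Lipschitz functions of the
payoffs, and they are the gradients of the conjugates `hᵢ*`. So the Hamiltonian `H` is differentiable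
with Lipschitz gradient `g`; its vector field `J g` has unique solutions, which continuous-time FTRL
follows (`RegularizedGame.IsFTRL.mk_eq_flow`).

*Symplecticity.* As `H` need not be twice differentiable, the usual variational equation for `Dψ` is
not available. Instead, put `𝒢(p) = ∫ (⟨g, z⟩ - 2 H)(φ_s p) ds`. Along two trajectories the derivative
of `ω(φ_s p, φ_s q)` equals the difference of the integrands up to a multiple of `‖φ_s p - φ_s q‖²`, so
`ω(ψ p, ψ q) - ω(p, q) = 𝒢(q) - 𝒢(p) + O(‖p - q‖²)` (`abs_symplecticForm_flow_sub_le`). Hence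
`D𝒢(p) u = ω(ψ p, Dψ(p) u) - ω(p, u)`, and the symmetry of the second derivative of `𝒢` says that
`Dψ(p)` preserves `ω` (`symplecticForm_fderiv_flow`).

*Linear uncertainty.* Let `P` be the covariance matrix of `Z`. If a symplectic image `S₀ B(r) + b` lies
in the ellipsoid of `P`, then `r ‖S₀ᵀ e‖ ≤ Δ⟨e, Z⟩` for all `e`. Since `S₀ᵀ` preserves `ω` and
`|ω(u, w)| ≤ ‖u‖ ‖w‖`, this gives `w_L(P) |ω(e, f)| ≤ π Δ⟨e, Z⟩ Δ⟨f, Z⟩` (`covWidth_mul_abs_le`). With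
`S = Dψ(m)`, `e = Sᵀ e_X` and `f = Sᵀ e_y` it is the inequality, without the factor `1 / √2`, for the
linearization of `ψ` at the mean `m`.

*Remainder.* The Taylor remainder of `ψ` at `m` is at most `K ‖Z - m‖²` and at most `2 Λ ‖Z - m‖`, where
`Λ` bounds `‖Dψ‖`. Splitting its second moment at `‖Z - m‖ = ρ σ`, with `ρ` chosen by the tail bound and
then `δ` small, makes its root mean square at most `ε σ`. As `w_L(P) ≥ c σ²`, neither standard deviation
of the linearization can be small compared with `σ`, so that each loses at most a tenth, and
`0.9² ≥ 1 / √2` (`exists_uncertainty_of_symplectic`).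
-/

noncomputable section

/-! ### Convex conjugates of strongly convex functions -/

/-- A quadratic bound on the remainder of an affine approximation gives differentiability. -/
theorem hasFDerivAt_of_norm_sub_le_sq {E F : Type*} [NormedAddCommGroup E] [NormedSpace ℝ E]
    [NormedAddCommGroup F] [NormedSpace ℝ F] {f : E → F} {f' : E →L[ℝ] F} {x : E} (C : ℝ)
    (h : ∀ y, ‖f y - f x - f' (y - x)‖ ≤ C * ‖y - x‖ ^ 2) : HasFDerivAt f f' x := by
  refine HasFDerivAt.of_isLittleO ?_
  have h1 : (fun y => f y - f x - f' (y - x)) =O[𝓝 x] fun y => ‖y - x‖ ^ 2 :=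
    Asymptotics.IsBigO.of_bound C (Eventually.of_forall fun y => by simpa using h y)
  exact h1.trans_isLittleO (Asymptotics.isLittleO_norm_right.1
    (by simpa using Asymptotics.isLittleO_pow_sub_sub x one_lt_two))

section Conjugate

variable {E : Type*} [NormedAddCommGroup E] [InnerProductSpace ℝ E]
  {s : Set E} {h : E → ℝ} {m : ℝ}

/-- A linear function minus a strongly convex lower semicontinuous function attains its maximum on a
closed set: strong convexity makes the difference coercive, so that a ball around any point of the set
contains a maximizer. -/
theorem StrongConvexOn.exists_isMaxOn_inner_sub [ProperSpace E] (hm : 0 < m)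
    (hconv : StrongConvexOn s m h) (hlsc : LowerSemicontinuousOn h s) (hcl : IsClosed s)
    (hne : s.Nonempty) (y : E) :
    ∃ x ∈ s, IsMaxOn (fun u => inner ℝ u y - h u) s x := by
  obtain ⟨x₀, hx₀⟩ := hne
  set k : E → ℝ := fun u => h u - inner ℝ u y with hk
  have klsc : LowerSemicontinuousOn k s := by
    have h1 : ContinuousOn (fun u : E => -inner ℝ u y) s := by fun_prop
    simpa [hk, sub_eq_add_neg] using hlsc.add h1.lowerSemicontinuousOn
  have hmin : ∀ R : ℝ, 0 ≤ R → ∃ x ∈ s ∩ Metric.closedBall x₀ R,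
      IsMinOn k (s ∩ Metric.closedBall x₀ R) x := fun R hR =>
    LowerSemicontinuousOn.exists_isMinOn ⟨x₀, hx₀, Metric.mem_closedBall_self hR⟩
      ((isCompact_closedBall x₀ R).inter_left hcl) (klsc.mono Set.inter_subset_left)
  obtain ⟨x₁, hx₁, hx₁min⟩ := hmin 1 zero_le_one
  have hB : 0 ≤ k x₀ - k x₁ :=
    sub_nonneg.2 (hx₁min ⟨hx₀, Metric.mem_closedBall_self zero_le_one⟩)
  set B := k x₀ - k x₁ with hBdef
  have hR : 0 ≤ 1 + 2 * B / m := by positivity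
  obtain ⟨x₂, hx₂, hx₂min⟩ := hmin (1 + 2 * B / m) hR
  have hglob : ∀ u ∈ s, k x₂ ≤ k u := by
    intro u hu
    by_cases hd : ‖u - x₀‖ ≤ 1 + 2 * B / m
    · exact hx₂min ⟨hu, by simpa [dist_eq_norm] using hd⟩
    refine (hx₂min ⟨hx₀, Metric.mem_closedBall_self hR⟩ : k x₂ ≤ k x₀).trans ?_
    push Not at hd
    set d := ‖u - x₀‖ with hddef
    have hBm : 0 ≤ 2 * B / m := by positivity
    have hd1 : 1 < d := by linarith
    have hd0 : 0 < d := by linarith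
    -- compare with the minimum on the unit ball at the point of the segment at distance one
    have hb1 : 0 ≤ 1 - 1 / d := by
      rw [sub_nonneg, div_le_one hd0]; exact hd1.le
    have hc := hconv.2 hx₀ hu hb1 (by positivity : 0 ≤ 1 / d) (by ring)
    have hp : (1 - 1 / d) • x₀ + (1 / d) • u ∈ s :=
      hconv.1 hx₀ hu hb1 (by positivity : 0 ≤ 1 / d) (by ring)
    have hpd : (1 - 1 / d) • x₀ + (1 / d) • u - x₀ = (1 / d) • (u - x₀) := by
      module
    have hpb : (1 - 1 / d) • x₀ + (1 / d) • u ∈ Metric.closedBall x₀ 1 := by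
      rw [Metric.mem_closedBall, dist_eq_norm, hpd, norm_smul, Real.norm_of_nonneg (by positivity),
        ← hddef, one_div, inv_mul_cancel₀ hd0.ne']
    have h1 : k x₁ ≤ k ((1 - 1 / d) • x₀ + (1 / d) • u) := hx₁min ⟨hp, hpb⟩
    have h2 : k ((1 - 1 / d) • x₀ + (1 / d) • u) ≤
        (1 - 1 / d) * k x₀ + 1 / d * k u - (1 - 1 / d) * (1 / d) * (m / 2 * d ^ 2) := by
      simp only [hk, inner_add_left, real_inner_smul_left]
      rw [norm_sub_rev, ← hddef] at hc
      simp only [smul_eq_mul] at hc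
      linarith
    have h3 : B ≤ (d - 1) * (m / 2) := by
      have : 2 * B / m < d - 1 := by linarith
      rw [div_lt_iff₀ hm] at this
      linarith
    have h4 : k x₁ * d ≤ (d - 1) * k x₀ + k u - (d - 1) * (m / 2 * d) := by
      have := mul_le_mul_of_nonneg_right (h1.trans h2) hd0.le
      field_simp at this ⊢
      linarith
    nlinarith [mul_le_mul_of_nonneg_right h3 hd0.le]
  exact ⟨x₂, hx₂.1, fun u hu => by
    have := hglob u hu
    simp only [hk] at this
    simp only [Set.mem_ofPred_eq]
    linarith⟩

/-- Quadratic decay away from the maximizer. Comparing with the midpoint of `u` and `x` gives the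
constant `m / 4`; the optimal one is `m / 2`. -/
theorem StrongConvexOn.inner_sub_add_le_of_isMaxOn (hconv : StrongConvexOn s m h) {x y u : E}
    (hx : x ∈ s) (hmax : IsMaxOn (fun u => inner ℝ u y - h u) s x) (hu : u ∈ s) :
    inner ℝ u y - h u + m / 4 * ‖u - x‖ ^ 2 ≤ inner ℝ x y - h x := by
  have hc := hconv.2 hx hu (by norm_num : (0 : ℝ) ≤ 1 / 2) (by norm_num : (0 : ℝ) ≤ 1 / 2)
    (by norm_num)
  have hp := hmax (hconv.1 hx hu (by norm_num : (0 : ℝ) ≤ 1 / 2) (by norm_num : (0 : ℝ) ≤ 1 / 2)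
    (by norm_num))
  simp only [Set.mem_ofPred_eq, inner_add_left, real_inner_smul_left] at hp
  rw [norm_sub_rev] at hc
  simp only [smul_eq_mul] at hc
  linarith

/-- The maximizer depends strongly monotonically on the linear functional. -/
theorem StrongConvexOn.mul_sq_norm_sub_le (hconv : StrongConvexOn s m h) {x y x' y' : E}
    (hx : x ∈ s) (hmax : IsMaxOn (fun u => inner ℝ u y - h u) s x)
    (hx' : x' ∈ s) (hmax' : IsMaxOn (fun u => inner ℝ u y' - h u) s x') :
    m / 2 * ‖x' - x‖ ^ 2 ≤ inner ℝ (x' - x) (y' - y) := by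
  have h1 := hconv.inner_sub_add_le_of_isMaxOn hx hmax hx'
  have h2 := hconv.inner_sub_add_le_of_isMaxOn hx' hmax' hx
  rw [norm_sub_rev] at h2
  simp only [inner_sub_left, inner_sub_right]
  linarith

theorem StrongConvexOn.norm_sub_le_of_isMaxOn (hm : 0 < m) (hconv : StrongConvexOn s m h)
    {x y x' y' : E} (hx : x ∈ s) (hmax : IsMaxOn (fun u => inner ℝ u y - h u) s x)
    (hx' : x' ∈ s) (hmax' : IsMaxOn (fun u => inner ℝ u y' - h u) s x') :
    ‖x' - x‖ ≤ 2 / m * ‖y' - y‖ := by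
  have h1 := (hconv.mul_sq_norm_sub_le hx hmax hx' hmax').trans (real_inner_le_norm _ _)
  rcases (norm_nonneg (x' - x)).eq_or_lt with h0 | h0
  · rw [← h0]; positivity
  have h2 : m / 2 * ‖x' - x‖ ≤ ‖y' - y‖ := le_of_mul_le_mul_left (by linarith) h0
  rw [div_mul_eq_mul_div, le_div_iff₀ hm]
  linarith

theorem sSup_inner_sub_eq_of_isMaxOn {x y : E} (hx : x ∈ s)
    (hmax : IsMaxOn (fun u => inner ℝ u y - h u) s x) :
    sSup ((fun u => inner ℝ u y - h u) '' s) = inner ℝ x y - h x :=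
  IsGreatest.csSup_eq ⟨⟨x, hx, rfl⟩, by rintro _ ⟨u, hu, rfl⟩; exact hmax hu⟩

/-- The derivative of the convex conjugate is the maximizer. -/
theorem StrongConvexOn.hasFDerivAt_sSup_inner_sub (hm : 0 < m) (hconv : StrongConvexOn s m h)
    {g : E → E} (hg : ∀ y, g y ∈ s)
    (hmax : ∀ y, IsMaxOn (fun u => inner ℝ u y - h u) s (g y)) (y : E) :
    HasFDerivAt (fun y => sSup ((fun u => inner ℝ u y - h u) '' s)) (innerSL ℝ (g y)) y := by
  refine hasFDerivAt_of_norm_sub_le_sq (2 / m) fun y' => ?_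
  rw [sSup_inner_sub_eq_of_isMaxOn (hg y') (hmax y'), sSup_inner_sub_eq_of_isMaxOn (hg y) (hmax y),
    innerSL_apply_apply, Real.norm_eq_abs, abs_le]
  have h1 : inner ℝ (g y) y' - h (g y) ≤ inner ℝ (g y') y' - h (g y') := hmax y' (hg y)
  have h2 : inner ℝ (g y') y - h (g y') ≤ inner ℝ (g y) y - h (g y) := hmax y (hg y')
  have h3 := (real_inner_le_norm (g y' - g y) (y' - y)).trans (mul_le_mul_of_nonneg_right
    (hconv.norm_sub_le_of_isMaxOn hm (hg y) (hmax y) (hg y') (hmax y')) (norm_nonneg (y' - y)))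
  have h4 : 0 ≤ 2 / m * ‖y' - y‖ ^ 2 := by positivity
  simp only [inner_sub_right, inner_sub_left] at *
  constructor <;> nlinarith

end Conjugate

/-! ### Flows of Hamiltonians with Lipschitz gradient are symplectic -/

/-- Taylor's bound for a function with Lipschitz derivative. -/
theorem norm_sub_sub_le_sq_of_norm_fderiv_sub_le {E F : Type*} [NormedAddCommGroup E]
    [NormedSpace ℝ E] [NormedAddCommGroup F] [NormedSpace ℝ F] {f : E → F} {f' : E → E →L[ℝ] F}
    {C : ℝ} (hf : ∀ z, HasFDerivAt f (f' z) z) {x : E} (hC : 0 ≤ C)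
    (h : ∀ z, ‖f' z - f' x‖ ≤ C * ‖z - x‖) (y : E) :
    ‖f y - f x - f' x (y - x)‖ ≤ C * ‖y - x‖ ^ 2 := by
  have := (convex_closedBall x ‖y - x‖).norm_image_sub_le_of_norm_hasFDerivWithin_le'
    (φ := f' x) (C := C * ‖y - x‖) (x := x) (y := y)
    (fun z _ => (hf z).hasFDerivWithinAt)
    (fun z hz => (h z).trans (mul_le_mul_of_nonneg_left (by simpa [dist_eq_norm] using hz) hC))
    (Metric.mem_closedBall_self (norm_nonneg _)) (by simp [dist_eq_norm])
  calc _ ≤ _ := this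
    _ = _ := by ring

/-- Gronwall's bound for the flow of a Lipschitz vector field. -/
theorem norm_flow_sub_le {E : Type*} [NormedAddCommGroup E] [NormedSpace ℝ E] {f : E → E} {L : NNReal}
    (hf : LipschitzWith L f) {t₀ : ℝ} {φ : ℝ → E → E} (hφ₀ : ∀ z, φ t₀ z = z)
    (hφ : ∀ z t, t₀ ≤ t → HasDerivWithinAt (fun s => φ s z) (f (φ t z)) (Set.Ici t₀) t)
    {t : ℝ} (ht : t₀ ≤ t) (p q : E) :
    ‖φ t q - φ t p‖ ≤ Real.exp (L * (t - t₀)) * ‖q - p‖ := by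
  have hc : ∀ z, ContinuousOn (fun s => φ s z) (Set.Icc t₀ t) := fun z s hs =>
    ((hφ z s hs.1).continuousWithinAt).mono Set.Icc_subset_Ici_self
  have hd : ∀ z, ∀ s ∈ Set.Ico t₀ t,
      HasDerivWithinAt (fun s => φ s z) (f (φ s z)) (Set.Ici s) s := fun z s hs =>
    (hφ z s hs.1).mono (Set.Ici_subset_Ici.2 hs.1)
  have := dist_le_of_trajectories_ODE (v := fun _ => f) (K := L) (δ := ‖q - p‖) (fun _ => hf)
    (hc q) (hd q) (hc p) (hd p) (by simp [hφ₀, dist_eq_norm]) t ⟨ht, le_rfl⟩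
  rwa [dist_eq_norm, mul_comm] at this

section Symplectic

variable {E : Type*} [NormedAddCommGroup E] [InnerProductSpace ℝ E] {J : E →L[ℝ] E} {H : E → ℝ}
  {g : E → E} {L : NNReal} {t₀ : ℝ} {φ : ℝ → E → E}

/-- The integral of `⟨∇H, z⟩ - 2 H` along trajectories is, to second order in the distance of the
initial points, a generating function of the flow: the change of `⟨J p, q⟩` along the flow is the
difference of its values. This needs no second derivative of `H`. -/
theorem abs_symplecticForm_flow_sub_le (hJ : ∀ u v, inner ℝ (J u) (J v) = inner ℝ u v)
    (hJ' : ∀ u v, inner ℝ (J u) v = -inner ℝ u (J v))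
    (hH : ∀ z, HasFDerivAt H (innerSL ℝ (g z)) z) (hg : LipschitzWith L g)
    (hφ₀ : ∀ z, φ t₀ z = z)
    (hφ : ∀ z t, t₀ ≤ t → HasDerivWithinAt (fun s => φ s z) (J (g (φ t z))) (Set.Ici t₀) t)
    {t : ℝ} (ht : t₀ ≤ t) : ∃ C : ℝ, ∀ p q,
      |inner ℝ (J (φ t p)) (φ t q) - inner ℝ (J p) q -
        ((∫ s in t₀..t, (inner ℝ (g (φ s q)) (φ s q) - 2 * H (φ s q))) -
          ∫ s in t₀..t, (inner ℝ (g (φ s p)) (φ s p) - 2 * H (φ s p)))| ≤ C * ‖q - p‖ ^ 2 := by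
  have hJn : ∀ u, ‖J u‖ = ‖u‖ := fun u => by
    rw [← sq_eq_sq₀ (norm_nonneg _) (norm_nonneg _), ← real_inner_self_eq_norm_sq,
      ← real_inner_self_eq_norm_sq, hJ]
  have hJg : LipschitzWith L fun z => J (g z) := LipschitzWith.of_dist_le_mul fun x y => by
    rw [dist_eq_norm, ← map_sub, hJn, ← dist_eq_norm]
    exact hg.dist_le_mul x y
  have hHT : ∀ P Q, |H Q - H P - inner ℝ (g P) (Q - P)| ≤ L * ‖Q - P‖ ^ 2 := fun P Q => by
    have := norm_sub_sub_le_sq_of_norm_fderiv_sub_le hH (x := P) L.2 (fun z => by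
      rw [← map_sub, innerSL_apply_norm, ← dist_eq_norm, ← dist_eq_norm]
      exact hg.dist_le_mul z P) Q
    simpa using this
  set M := Real.exp (L * (t - t₀)) with hM
  refine ⟨2 * L * M ^ 2 * (t - t₀), fun p q => ?_⟩
  have hcφ : ∀ z, ContinuousOn (fun s => φ s z) (Set.Icc t₀ t) := fun z s hs =>
    ((hφ z s hs.1).continuousWithinAt).mono Set.Icc_subset_Ici_self
  have hcH : Continuous H := continuous_iff_continuousAt.2 fun z => (hH z).continuousAt
  have hcg : Continuous g := hg.continuous
  have hcF : ∀ z, ContinuousOn (fun s => inner ℝ (g (φ s z)) (φ s z) - 2 * H (φ s z))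
      (Set.Icc t₀ t) := fun z =>
    ((hcg.comp_continuousOn (hcφ z)).inner (𝕜 := ℝ) (hcφ z)).sub
      (continuousOn_const.mul (hcH.comp_continuousOn (hcφ z)))
  have hiF : ∀ z, IntervalIntegrable (fun s => inner ℝ (g (φ s z)) (φ s z) - 2 * H (φ s z))
      volume t₀ t := fun z => (hcF z).intervalIntegrable_of_Icc ht
  set W' : ℝ → ℝ := fun s => inner ℝ (J (φ s p)) (J (g (φ s q))) +
    inner ℝ (J (J (g (φ s p)))) (φ s q) with hW'
  have hcW' : ContinuousOn W' (Set.Icc t₀ t) :=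
    ((J.continuous.comp_continuousOn (hcφ p)).inner (𝕜 := ℝ)
      (J.continuous.comp_continuousOn (hcg.comp_continuousOn (hcφ q)))).add
    ((J.continuous.comp_continuousOn (J.continuous.comp_continuousOn
      (hcg.comp_continuousOn (hcφ p)))).inner (𝕜 := ℝ) (hcφ q))
  have hiW' : IntervalIntegrable W' volume t₀ t := hcW'.intervalIntegrable_of_Icc ht
  have hFTC : ∫ s in t₀..t, W' s = inner ℝ (J (φ t p)) (φ t q) - inner ℝ (J p) q := by
    rw [intervalIntegral.integral_eq_sub_of_hasDeriv_right_of_le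
      (f := fun s => inner ℝ (J (φ s p)) (φ s q)) ht
      ((J.continuous.comp_continuousOn (hcφ p)).inner (𝕜 := ℝ) (hcφ q)) (fun s hs => ?_) hiW',
      hφ₀, hφ₀]
    have hd : ∀ z, HasDerivWithinAt (fun s => φ s z) (J (g (φ s z))) (Set.Ioi s) s := fun z =>
      (hφ z s hs.1.le).mono fun r hr => hs.1.le.trans (le_of_lt hr)
    exact (J.hasFDerivAt.comp_hasDerivWithinAt s (hd p)).inner ℝ (hd q)
  rw [← hFTC, ← intervalIntegral.integral_sub (hiF q) (hiF p),
    ← intervalIntegral.integral_sub hiW' ((hiF q).sub (hiF p))]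
  have hb := intervalIntegral.norm_integral_le_of_norm_le_const (a := t₀) (b := t)
    (f := fun s => W' s - (inner ℝ (g (φ s q)) (φ s q) - 2 * H (φ s q) -
      (inner ℝ (g (φ s p)) (φ s p) - 2 * H (φ s p)))) (C := 2 * L * M ^ 2 * ‖q - p‖ ^ 2)
    (fun s hs => ?_)
  · rw [Real.norm_eq_abs, abs_of_nonneg (sub_nonneg.2 ht)] at hb
    linarith
  rw [Set.uIoc_of_le ht] at hs
  have h1 := hHT (φ s p) (φ s q)
  have h2 := hHT (φ s q) (φ s p)
  have h3 : ‖φ s q - φ s p‖ ≤ M * ‖q - p‖ :=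
    (norm_flow_sub_le hJg hφ₀ hφ hs.1.le p q).trans (by
      rw [hM]; gcongr; exact hs.2)
  have h4 : (L : ℝ) * ‖φ s q - φ s p‖ ^ 2 ≤ L * M ^ 2 * ‖q - p‖ ^ 2 := by
    rw [mul_assoc, ← mul_pow]; gcongr
  have h5 : inner ℝ (J (J (g (φ s p)))) (φ s q) = -inner ℝ (g (φ s p)) (φ s q) := by
    rw [hJ', hJ]
  rw [norm_sub_rev] at h2
  rw [abs_le] at h1 h2
  simp only [hW', hJ, h5, Real.norm_eq_abs]
  simp only [inner_sub_right] at h1 h2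
  rw [real_inner_comm (g (φ s q)) (φ s p), abs_le]
  constructor <;> linarith [h1.1, h1.2, h2.1, h2.2]

/-- The flow map of a Hamiltonian with Lipschitz gradient preserves the symplectic form `⟨J u, v⟩` if
it is twice continuously differentiable. The pullback of the Liouville form differs from the form
itself by an exact form, and second derivatives are symmetric. -/
theorem symplecticForm_fderiv_flow (hJ : ∀ u v, inner ℝ (J u) (J v) = inner ℝ u v)
    (hJ' : ∀ u v, inner ℝ (J u) v = -inner ℝ u (J v))
    (hH : ∀ z, HasFDerivAt H (innerSL ℝ (g z)) z) (hg : LipschitzWith L g)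
    (hφ₀ : ∀ z, φ t₀ z = z)
    (hφ : ∀ z t, t₀ ≤ t → HasDerivWithinAt (fun s => φ s z) (J (g (φ t z))) (Set.Ici t₀) t)
    {t : ℝ} (ht : t₀ ≤ t) (hψ : ContDiff ℝ 2 (φ t)) (z u w : E) :
    inner ℝ (J (fderiv ℝ (φ t) z u)) (fderiv ℝ (φ t) z w) = inner ℝ (J u) w := by
  obtain ⟨C, hC⟩ := abs_symplecticForm_flow_sub_le hJ hJ' hH hg hφ₀ hφ ht
  have hJ0 : ∀ v, inner ℝ (J v) v = 0 := fun v => by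
    have := hJ' v v
    rw [real_inner_comm (J v) v] at this
    linarith
  have hd : ∀ p, HasFDerivAt (φ t) (fderiv ℝ (φ t) p) p := fun p =>
    (hψ.differentiable (by norm_num) p).hasFDerivAt
  set 𝒢 : E → ℝ := fun p => ∫ s in t₀..t, (inner ℝ (g (φ s p)) (φ s p) - 2 * H (φ s p)) with h𝒢
  set 𝒢' : E → E →L[ℝ] ℝ := fun p =>
    (innerSL ℝ (J (φ t p))).comp (fderiv ℝ (φ t) p) - innerSL ℝ (J p) with h𝒢'
  have h1 : ∀ p, HasFDerivAt 𝒢 (𝒢' p) p := by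
    intro p
    have ha : HasFDerivAt (fun q => inner ℝ (J (φ t p)) (φ t q) - inner ℝ (J p) q) (𝒢' p) p :=
      (((innerSL ℝ (J (φ t p))).hasFDerivAt).comp p (hd p)).sub (innerSL ℝ (J p)).hasFDerivAt
    have hb : HasFDerivAt (fun q => inner ℝ (J (φ t p)) (φ t q) - inner ℝ (J p) q - 𝒢 q)
        (0 : E →L[ℝ] ℝ) p := by
      refine hasFDerivAt_of_norm_sub_le_sq C fun q => ?_
      have := hC p q
      rw [hJ0, hJ0, Real.norm_eq_abs]
      convert this using 2
      simp only [zero_apply, h𝒢]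
      ring
    simpa using (ha.sub hb).congr_of_eventuallyEq (f₁ := 𝒢) (Eventually.of_forall fun q => by simp)
  have hJc : HasFDerivAt (fun p => innerSL ℝ (J (φ t p)))
      (((innerSL ℝ).comp J).comp (fderiv ℝ (φ t) z)) z :=
    (((innerSL ℝ).comp J).hasFDerivAt).comp z (hd z)
  have hdd : HasFDerivAt (fderiv ℝ (φ t)) (fderiv ℝ (fderiv ℝ (φ t)) z) z :=
    (((hψ.fderiv_right (m := 1) (by norm_num)).differentiable (by norm_num)) z).hasFDerivAt
  have h2 : HasFDerivAt 𝒢' _ z := (hJc.clm_comp hdd).sub (((innerSL ℝ).comp J).hasFDerivAt)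
  have h3 := second_derivative_symmetric h1 h2 u w
  have h4 := second_derivative_symmetric hd hdd u w
  have h5 : ∀ a b : E, inner ℝ (J a) b = -inner ℝ (J b) a := fun a b => by
    rw [hJ', real_inner_comm]
  simp at h3
  rw [h4] at h3
  have h6 := h5 w u
  have h7 := h5 (fderiv ℝ (φ t) z w) (fderiv ℝ (φ t) z u)
  linarith

end Symplectic

/-! ### The symplectic form on phase space -/

namespace Phase

variable {n : ℕ}

/-- The position part as a continuous linear map. -/
def posL (n : ℕ) : Phase n →L[ℝ] EuclideanSpace ℝ (Fin n) :=
  LinearMap.toContinuousLinearMap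
    { toFun := Phase.pos
      map_add' := fun _ _ => by ext; simp [Phase.pos]
      map_smul' := fun _ _ => by ext; simp [Phase.pos] }

/-- The momentum part as a continuous linear map. -/
def momL (n : ℕ) : Phase n →L[ℝ] EuclideanSpace ℝ (Fin n) :=
  LinearMap.toContinuousLinearMap
    { toFun := Phase.mom
      map_add' := fun _ _ => by ext; simp [Phase.mom]
      map_smul' := fun _ _ => by ext; simp [Phase.mom] }

/-- The pairing `(X, y) ↦ Phase.mk X y` as a continuous linear map. -/
def mkL (n : ℕ) : EuclideanSpace ℝ (Fin n) × EuclideanSpace ℝ (Fin n) →L[ℝ] Phase n :=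
  LinearMap.toContinuousLinearMap
    { toFun := fun p => Phase.mk p.1 p.2
      map_add' := fun _ _ => by ext a; cases a <;> simp [Phase.mk]
      map_smul' := fun _ _ => by ext a; cases a <;> simp [Phase.mk] }

/-- The complex structure `(X, y) ↦ (y, -X)`; the symplectic form is `⟨J u, w⟩`. -/
def symplJ (n : ℕ) : Phase n →L[ℝ] Phase n :=
  (mkL n).comp ((momL n).prod (-(posL n)))

@[simp] theorem posL_apply (z : Phase n) : posL n z = z.pos := rfl

@[simp] theorem momL_apply (z : Phase n) : momL n z = z.mom := rfl

@[simp] theorem mkL_apply (p : EuclideanSpace ℝ (Fin n) × EuclideanSpace ℝ (Fin n)) :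
    mkL n p = Phase.mk p.1 p.2 := rfl

@[simp] theorem pos_mk (X y : EuclideanSpace ℝ (Fin n)) : (Phase.mk X y).pos = X := by
  ext; simp [Phase.mk, Phase.pos]

@[simp] theorem mom_mk (X y : EuclideanSpace ℝ (Fin n)) : (Phase.mk X y).mom = y := by
  ext; simp [Phase.mk, Phase.mom]

@[simp] theorem mk_inl (X y : EuclideanSpace ℝ (Fin n)) (a : Fin n) :
    Phase.mk X y (Sum.inl a) = X a := rfl

@[simp] theorem mk_inr (X y : EuclideanSpace ℝ (Fin n)) (a : Fin n) :
    Phase.mk X y (Sum.inr a) = y a := rfl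

@[simp] theorem symplJ_inl (u : Phase n) (a : Fin n) : symplJ n u (Sum.inl a) = u (Sum.inr a) := rfl

@[simp] theorem symplJ_inr (u : Phase n) (a : Fin n) : symplJ n u (Sum.inr a) = -u (Sum.inl a) := rfl

theorem exists_lipschitzWith_mk {α : Type*} [PseudoEMetricSpace α]
    {f g : α → EuclideanSpace ℝ (Fin n)} {K K' : NNReal} (hf : LipschitzWith K f)
    (hg : LipschitzWith K' g) : ∃ L, LipschitzWith L fun z => Phase.mk (f z) (g z) := by
  have h := (mkL n).lipschitz.comp (hf.prodMk hg)
  exact ⟨_, h⟩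

theorem symplJ_mk (X y : EuclideanSpace ℝ (Fin n)) : symplJ n (Phase.mk X y) = Phase.mk y (-X) := by
  ext a; cases a <;> simp

theorem inner_mk_left (X y : EuclideanSpace ℝ (Fin n)) (w : Phase n) :
    inner ℝ (Phase.mk X y) w = inner ℝ X w.pos + inner ℝ y w.mom := by
  simp [PiLp.inner_apply, Fintype.sum_sum_type, Phase.pos, Phase.mom]

theorem inner_symplJ_symplJ (u v : Phase n) :
    inner ℝ (symplJ n u) (symplJ n v) = inner ℝ u v := by
  simp [PiLp.inner_apply, Fintype.sum_sum_type, add_comm]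

theorem inner_symplJ_left (u v : Phase n) :
    inner ℝ (symplJ n u) v = -inner ℝ u (symplJ n v) := by
  simp [PiLp.inner_apply, Fintype.sum_sum_type, add_comm]

theorem symplJ_symplJ (u : Phase n) : symplJ n (symplJ n u) = -u := by
  ext a; cases a <;> simp

theorem norm_symplJ (u : Phase n) : ‖symplJ n u‖ = ‖u‖ := by
  rw [← sq_eq_sq₀ (norm_nonneg _) (norm_nonneg _), ← real_inner_self_eq_norm_sq,
    ← real_inner_self_eq_norm_sq, inner_symplJ_symplJ]

theorem abs_inner_symplJ_le (u v : Phase n) : |inner ℝ (symplJ n u) v| ≤ ‖u‖ * ‖v‖ := by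
  simpa [norm_symplJ] using abs_real_inner_le_norm (symplJ n u) v

/-- If a linear map preserves the symplectic form, so does its adjoint. -/
theorem inner_symplJ_adjoint {S : Phase n →L[ℝ] Phase n}
    (hS : ∀ u w, inner ℝ (symplJ n (S u)) (S w) = inner ℝ (symplJ n u) w) (u w : Phase n) :
    inner ℝ (symplJ n (S.adjoint u)) (S.adjoint w) = inner ℝ (symplJ n u) w := by
  -- the hypothesis says that `-J S† J` is a left inverse of `S`; in finite dimension it is two-sided
  set T : Phase n →L[ℝ] Phase n := -((symplJ n).comp (S.adjoint.comp (symplJ n))) with hT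
  have h1 : (T : Phase n →ₗ[ℝ] Phase n) * (S : Phase n →ₗ[ℝ] Phase n) = 1 := by
    ext1 x
    refine ext_inner_right ℝ fun y => ?_
    have h2 := hS x (symplJ n y)
    simp only [hT, Module.End.mul_apply, ContinuousLinearMap.coe_coe, Module.End.one_apply,
      neg_apply, ContinuousLinearMap.comp_apply, inner_neg_left]
    rw [inner_symplJ_left, neg_neg, ContinuousLinearMap.adjoint_inner_left, h2, inner_symplJ_symplJ]
  have h3 := mul_eq_one_comm.1 h1
  have h4 : ∀ x, S (T x) = x := fun x => LinearMap.congr_fun h3 x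
  have h5 := h4 (symplJ n w)
  simp only [hT, neg_apply, ContinuousLinearMap.comp_apply, symplJ_symplJ,
    map_neg, neg_neg] at h5
  rw [inner_symplJ_left, ContinuousLinearMap.adjoint_inner_left, h5, inner_symplJ_left]

theorem hamiltonianField_eq {H : Phase n → ℝ} {g z : Phase n}
    (h : HasFDerivAt H (innerSL ℝ g) z) : hamiltonianField H z = symplJ n g := by
  ext a
  cases a <;> simp [hamiltonianField, h.fderiv, EuclideanSpace.inner_single_right]

end Phase

/-! ### Primitives on a half-line -/

theorem continuousOn_Ici_of_eq_add_integral {F : Type*} [NormedAddCommGroup F]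
    [NormedSpace ℝ F] {X x : ℝ → F} {t₀ : ℝ}
    (hx : ∀ t, t₀ ≤ t → IntervalIntegrable x volume t₀ t)
    (hX : ∀ t, t₀ ≤ t → X t = X t₀ + ∫ s in t₀..t, x s) : ContinuousOn X (Set.Ici t₀) := by
  intro t ht
  have ht' : t₀ ≤ t := ht
  have h1 : ContinuousOn (fun t => X t₀ + ∫ s in t₀..t, x s) (Set.Icc t₀ (t + 1)) := by
    have := intervalIntegral.continuousOn_primitive_interval (a := t₀) (b := t + 1) (μ := volume)
      (f := x) (by
        rw [Set.uIcc_of_le (by linarith), integrableOn_Icc_iff_integrableOn_Ioc]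
        exact (intervalIntegrable_iff_integrableOn_Ioc_of_le (by linarith)).1
          (hx (t + 1) (by linarith)))
    rw [Set.uIcc_of_le (by linarith)] at this
    exact continuousOn_const.add this
  have h2 : ContinuousWithinAt X (Set.Icc t₀ (t + 1)) t :=
    (h1.congr fun s hs => hX s hs.1) t ⟨ht, by linarith⟩
  exact h2.mono_of_mem_nhdsWithin (Filter.inter_mem self_mem_nhdsWithin
    (mem_nhdsWithin_of_mem_nhds (Iic_mem_nhds (by linarith))))

/-- The fundamental theorem of calculus on a half-line. -/
theorem hasDerivWithinAt_Ici_of_eq_add_integral {F : Type*} [NormedAddCommGroup F]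
    [NormedSpace ℝ F] [CompleteSpace F] {X x : ℝ → F} {t₀ t : ℝ} (ht : t₀ ≤ t)
    (hx : IntervalIntegrable x volume t₀ t) (hxc : ContinuousOn x (Set.Ici t₀))
    (hX : ∀ t, t₀ ≤ t → X t = X t₀ + ∫ s in t₀..t, x s) :
    HasDerivWithinAt X (x t) (Set.Ici t) t := by
  have hsub : Set.Ioi t ⊆ Set.Ici t₀ := fun s hs => ht.trans (le_of_lt hs)
  have h1 : HasDerivWithinAt (fun u => ∫ s in t₀..u, x s) (x t) (Set.Ici t) t :=
    intervalIntegral.integral_hasDerivWithinAt_right hx (t := Set.Ioi t)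
      ((hxc.mono hsub).stronglyMeasurableAtFilter_nhdsWithin measurableSet_Ioi t)
      ((hxc t ht).mono hsub)
  exact (h1.const_add (X t₀)).congr (fun s hs => hX s (ht.trans hs)) (hX t ht)

/-! ### The Hamiltonian of a game and continuous-time FTRL -/

namespace RegularizedGame

variable (G : RegularizedGame)

theorem exists_isResponse (i : Fin 2) (y : G.E i) : ∃ x, G.IsResponse i y x := by
  obtain ⟨m, hm, hc⟩ := G.reg_strongConvex i
  exact hc.exists_isMaxOn_inner_sub hm (G.reg_lsc i) (G.strategies_closed i)
    (G.strategies_nonempty i) y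

/-- The strategy `argmax_{x ∈ 𝒳ᵢ} (⟨x, y⟩ - hᵢ(x))`. -/
def response (i : Fin 2) (y : G.E i) : G.E i := (G.exists_isResponse i y).choose

theorem isResponse_response (i : Fin 2) (y : G.E i) : G.IsResponse i y (G.response i y) :=
  (G.exists_isResponse i y).choose_spec

variable {G} in
theorem IsResponse.eq_response {i : Fin 2} {y x : G.E i} (h : G.IsResponse i y x) :
    x = G.response i y := by
  obtain ⟨m, hm, hc⟩ := G.reg_strongConvex i
  have := hc.norm_sub_le_of_isMaxOn hm (G.isResponse_response i y).1 (G.isResponse_response i y).2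
    h.1 h.2
  rw [sub_self, norm_zero, mul_zero] at this
  exact sub_eq_zero.1 (norm_le_zero_iff.1 this)

theorem exists_lipschitzWith_response (i : Fin 2) : ∃ L, LipschitzWith L (G.response i) := by
  obtain ⟨m, hm, hc⟩ := G.reg_strongConvex i
  refine ⟨(2 / m).toNNReal, LipschitzWith.of_dist_le_mul fun y' y => ?_⟩
  rw [dist_eq_norm, dist_eq_norm, Real.coe_toNNReal _ (by positivity)]
  exact hc.norm_sub_le_of_isMaxOn hm (G.isResponse_response i y).1 (G.isResponse_response i y).2
    (G.isResponse_response i y').1 (G.isResponse_response i y').2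

theorem hasFDerivAt_conj (i : Fin 2) (y : G.E i) :
    HasFDerivAt (G.conj i) (innerSL ℝ (G.response i y)) y := by
  obtain ⟨m, hm, hc⟩ := G.reg_strongConvex i
  exact hc.hasFDerivAt_sSup_inner_sub hm (fun y => (G.isResponse_response i y).1)
    (fun y => (G.isResponse_response i y).2) y

/-- The linear map `x ↦ A^{(ij)} x` as a continuous linear map. -/
def actL (i j : Fin 2) : G.E j →L[ℝ] G.E i :=
  LinearMap.toContinuousLinearMap (G.payoff i j).toEuclideanLin

@[simp] theorem actL_apply (i j : Fin 2) (x : G.E j) : G.actL i j x = G.act i j x := rfl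

theorem inner_act (i j : Fin 2) (hij : i ≠ j) (x : G.E j) (w : G.E i) :
    inner ℝ (G.act i j x) w = -inner ℝ x (G.act j i w) := by
  have h : G.payoff i j = -(G.payoff j i).conjTranspose := by
    rw [Matrix.conjTranspose_eq_transpose_of_trivial]; exact G.zeroSum i j hij
  rw [act, h, map_neg, LinearMap.neg_apply, inner_neg_left,
    Matrix.toEuclideanLin_conjTranspose_eq_adjoint, LinearMap.adjoint_inner_left, act]

/-- The gradient of the Hamiltonian of player `i`. -/
def hamiltonianGradient (i : Fin 2) (v : G.E (1 - i)) (z : Phase (G.n i)) : Phase (G.n i) :=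
  Phase.mk (-G.act i (1 - i) (G.response (1 - i) (v + G.act (1 - i) i z.pos)))
    (G.response i z.mom)

theorem hasFDerivAt_hamiltonian (i : Fin 2) (v : G.E (1 - i)) (z : Phase (G.n i)) :
    HasFDerivAt (G.hamiltonian i v) (innerSL ℝ (G.hamiltonianGradient i v z)) z := by
  have hne : ∀ i : Fin 2, i ≠ 1 - i := by decide
  have h1 : HasFDerivAt (fun z : Phase (G.n i) => v + G.act (1 - i) i z.pos)
      ((G.actL (1 - i) i).comp (Phase.posL (G.n i))) z :=
    (((G.actL (1 - i) i).comp (Phase.posL (G.n i))).hasFDerivAt).const_add v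
  have h2 : HasFDerivAt (fun z : Phase (G.n i) => z.mom) (Phase.momL (G.n i)) z :=
    (Phase.momL (G.n i)).hasFDerivAt
  have h3 : innerSL ℝ (G.hamiltonianGradient i v z) =
      (innerSL ℝ (G.response i z.mom)).comp (Phase.momL (G.n i)) +
        (innerSL ℝ (G.response (1 - i) (v + G.act (1 - i) i z.pos))).comp
          ((G.actL (1 - i) i).comp (Phase.posL (G.n i))) := by
    ext1 w
    simp [hamiltonianGradient, Phase.inner_mk_left, G.inner_act i (1 - i) (hne i), add_comm]
  rw [h3]
  exact ((G.hasFDerivAt_conj i z.mom).comp z h2).add ((G.hasFDerivAt_conj (1 - i) _).comp z h1)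

theorem exists_lipschitzWith_hamiltonianGradient (i : Fin 2) (v : G.E (1 - i)) :
    ∃ L, LipschitzWith L (G.hamiltonianGradient i v) := by
  obtain ⟨L₁, h₁⟩ := G.exists_lipschitzWith_response i
  obtain ⟨L₂, h₂⟩ := G.exists_lipschitzWith_response (1 - i)
  obtain ⟨L₃, h₃⟩ : ∃ L, LipschitzWith L fun z : Phase (G.n i) => v + G.act (1 - i) i z.pos :=
    ⟨_, (LipschitzWith.const v).add ((G.actL (1 - i) i).comp (Phase.posL (G.n i))).lipschitz⟩
  obtain ⟨L₄, h₄⟩ : ∃ L, LipschitzWith L fun z : Phase (G.n i) =>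
      -G.act i (1 - i) (G.response (1 - i) (v + G.act (1 - i) i z.pos)) :=
    ⟨_, (-G.actL i (1 - i)).lipschitz.comp (h₂.comp h₃)⟩
  obtain ⟨L₅, h₅⟩ : ∃ L, LipschitzWith L fun z : Phase (G.n i) => G.response i z.mom :=
    ⟨_, h₁.comp (Phase.momL (G.n i)).lipschitz⟩
  exact Phase.exists_lipschitzWith_mk h₄ h₅

theorem hamiltonianField_eq (i : Fin 2) (v : G.E (1 - i)) (z : Phase (G.n i)) :
    hamiltonianField (G.hamiltonian i v) z =
      Phase.symplJ (G.n i) (G.hamiltonianGradient i v z) :=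
  Phase.hamiltonianField_eq (G.hasFDerivAt_hamiltonian i v z)

theorem exists_lipschitzWith_hamiltonianField (i : Fin 2) (v : G.E (1 - i)) :
    ∃ L, LipschitzWith L (hamiltonianField (G.hamiltonian i v)) := by
  obtain ⟨L, hL⟩ := G.exists_lipschitzWith_hamiltonianGradient i v
  rw [funext (G.hamiltonianField_eq i v)]
  exact ⟨_, (Phase.symplJ (G.n i)).lipschitz.comp hL⟩

variable {G} in
/-- Continuous-time FTRL follows the Hamiltonian flow: the strategies are the responses to `y` and to
`v + A X`, hence continuous in time, so that `(X, y)` solves Hamilton's equations, whose solutions are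
unique because the vector field is Lipschitz. -/
theorem IsFTRL.mk_eq_flow {i : Fin 2} {v : G.E (1 - i)} {t₀ : ℝ} {X y : ℝ → G.E i}
    (h : G.IsFTRL i v t₀ X y) {φ : ℝ → Phase (G.n i) → Phase (G.n i)}
    (hφ : IsHamiltonianFlow (G.hamiltonian i v) t₀ φ) {t : ℝ} (ht : t₀ ≤ t) :
    Phase.mk (X t) (y t) = φ t (Phase.mk (X t₀) (y t₀)) := by
  obtain ⟨x, x', hx⟩ := h
  obtain ⟨L, hL⟩ := G.exists_lipschitzWith_hamiltonianField i v
  have hXc : ContinuousOn X (Set.Ici t₀) := continuousOn_Ici_of_eq_add_integral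
    (fun t ht => (hx t ht).1) (fun t ht => (hx t ht).2.2.2.2.1)
  have hia : ∀ t, t₀ ≤ t → IntervalIntegrable (fun s => G.act i (1 - i) (x' s)) volume t₀ t :=
    fun t ht => ⟨(G.actL i (1 - i)).integrable_comp (hx t ht).2.1.1,
      (G.actL i (1 - i)).integrable_comp (hx t ht).2.1.2⟩
  have hyc : ContinuousOn y (Set.Ici t₀) := continuousOn_Ici_of_eq_add_integral hia
    (fun t ht => (hx t ht).2.2.2.2.2)
  have hxr : ∀ t, t₀ ≤ t → x t = G.response i (y t) := fun t ht => (hx t ht).2.2.1.eq_response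
  have hxr' : ∀ t, t₀ ≤ t → x' t = G.response (1 - i) (v + G.act (1 - i) i (X t)) :=
    fun t ht => (hx t ht).2.2.2.1.eq_response
  have hrc : ∀ i, Continuous (G.response i) := fun i =>
    (G.exists_lipschitzWith_response i).choose_spec.continuous
  have hxc : ContinuousOn x (Set.Ici t₀) :=
    ((hrc i).comp_continuousOn hyc).congr fun t ht => hxr t ht
  have hxc' : ContinuousOn (fun s => G.act i (1 - i) (x' s)) (Set.Ici t₀) :=
    (G.actL i (1 - i)).continuous.comp_continuousOn <|
      ((hrc (1 - i)).comp_continuousOn (continuousOn_const.add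
        ((G.actL (1 - i) i).continuous.comp_continuousOn hXc))).congr fun t ht => hxr' t ht
  have hmk : ∀ t, t₀ ≤ t → HasDerivWithinAt (fun s => Phase.mk (X s) (y s))
      (hamiltonianField (G.hamiltonian i v) (Phase.mk (X t) (y t))) (Set.Ici t) t := by
    intro t ht
    have h1 := hasDerivWithinAt_Ici_of_eq_add_integral ht (hx t ht).1 hxc
      (fun t ht => (hx t ht).2.2.2.2.1)
    have h2 := hasDerivWithinAt_Ici_of_eq_add_integral ht (hia t ht) hxc'
      (fun t ht => (hx t ht).2.2.2.2.2)
    have h3 := (Phase.mkL (G.n i)).hasFDerivAt.comp_hasDerivWithinAt t (h1.prodMk h2)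
    rw [G.hamiltonianField_eq, hamiltonianGradient, Phase.symplJ_mk, Phase.pos_mk, Phase.mom_mk,
      neg_neg, ← hxr t ht, ← hxr' t ht]
    exact h3
  refine ODE_solution_unique (v := fun _ => hamiltonianField (G.hamiltonian i v)) (fun _ => hL)
    (a := t₀) (b := t) (f := fun s => Phase.mk (X s) (y s))
    (g := fun s => φ s (Phase.mk (X t₀) (y t₀)))
    ?_ (fun s hs => hmk s hs.1) ?_ ?_ (by simp [(hφ _).1]) ⟨ht, le_rfl⟩
  · exact ((Phase.mkL (G.n i)).continuous.comp_continuousOn (hXc.prodMk hyc)).mono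
      Set.Icc_subset_Ici_self
  · exact fun s hs => (((hφ _).2 s hs.1).continuousWithinAt).mono Set.Icc_subset_Ici_self
  · exact fun s hs => ((hφ _).2 s hs.1).mono (Set.Ici_subset_Ici.2 hs.1)

end RegularizedGame

/-! ### Standard deviations -/

section StdDev

variable {Ω : Type*} [MeasurableSpace Ω] {μ : Measure Ω}

theorem stdDev_nonneg (X : Ω → ℝ) : 0 ≤ stdDev X μ := Real.sqrt_nonneg _

theorem stdDev_sq (X : Ω → ℝ) : stdDev X μ ^ 2 = Var[X; μ] := Real.sq_sqrt (variance_nonneg X μ)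

variable [IsProbabilityMeasure μ]

theorem abs_covariance_le_stdDev_mul {X Y : Ω → ℝ} (hX : MemLp X 2 μ) (hY : MemLp Y 2 μ) :
    |cov[X, Y; μ]| ≤ stdDev X μ * stdDev Y μ := by
  have h : ∀ t : ℝ, 0 ≤ Var[X; μ] * (t * t) + 2 * cov[X, Y; μ] * t + Var[Y; μ] := fun t => by
    have h1 := variance_add (hX.const_mul t) hY
    rw [variance_const_mul, covariance_const_mul_left] at h1
    have h2 := variance_nonneg ((fun ω => t * X ω) + Y) μ
    nlinarith
  have h3 := discrim_le_zero h
  rw [discrim, ← stdDev_sq, ← stdDev_sq] at h3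
  exact abs_le_of_sq_le_sq (by nlinarith) (mul_nonneg (stdDev_nonneg _) (stdDev_nonneg _))

theorem stdDev_add_le {X Y : Ω → ℝ} (hX : MemLp X 2 μ) (hY : MemLp Y 2 μ) :
    stdDev (X + Y) μ ≤ stdDev X μ + stdDev Y μ := by
  refine Real.sqrt_le_iff.2 ⟨add_nonneg (stdDev_nonneg _) (stdDev_nonneg _), ?_⟩
  have := (le_abs_self _).trans (abs_covariance_le_stdDev_mul hX hY)
  rw [variance_add hX hY, ← stdDev_sq X, ← stdDev_sq Y]
  nlinarith

theorem stdDev_le_sqrt_integral {X : Ω → ℝ} (hX : AEStronglyMeasurable X μ) :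
    stdDev X μ ≤ Real.sqrt (∫ ω, X ω ^ 2 ∂μ) :=
  Real.sqrt_le_sqrt (variance_le_expectation_sq hX)

end StdDev

section Covariance

variable {Ω ι : Type*} [MeasurableSpace Ω] {μ : Measure Ω} [Fintype ι]
  {Z : Ω → EuclideanSpace ℝ ι}

theorem memLp_coord (hZ : MemLp Z 2 μ) (a : ι) : MemLp (fun ω => Z ω a) 2 μ :=
  (EuclideanSpace.proj (𝕜 := ℝ) a : EuclideanSpace ℝ ι →L[ℝ] ℝ).comp_memLp' hZ

theorem memLp_inner_left (hZ : MemLp Z 2 μ) (e : EuclideanSpace ℝ ι) :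
    MemLp (fun ω => inner ℝ e (Z ω)) 2 μ :=
  (innerSL ℝ e).comp_memLp' hZ

variable [IsProbabilityMeasure μ]

theorem inner_covMatrix [DecidableEq ι] (hZ : MemLp Z 2 μ) (e w : EuclideanSpace ℝ ι) :
    inner ℝ e ((covMatrix Z μ).toEuclideanLin w) =
      cov[fun ω => inner ℝ e (Z ω), fun ω => inner ℝ w (Z ω); μ] := by
  have hZa : ∀ a, MemLp (fun ω => Z ω a) 2 μ := fun a => memLp_coord hZ a
  have h : ∀ e : EuclideanSpace ℝ ι, (fun ω => inner ℝ e (Z ω)) =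
      fun ω => ∑ a, e a * Z ω a := fun e => by
    ext ω; simp [PiLp.inner_apply, mul_comm]
  rw [h e, h w, covariance_fun_sum_fun_sum (fun a => (hZa a).const_mul _)
    (fun a => (hZa a).const_mul _)]
  simp only [covariance_const_mul_left, covariance_const_mul_right]
  simp [PiLp.inner_apply, Matrix.mulVec, dotProduct, covMatrix, Finset.sum_mul]
  refine Finset.sum_congr rfl fun a _ => Finset.sum_congr rfl fun b _ => ?_
  ring

/-- The half-width of the covariance ellipsoid in direction `e` is at most the standard deviation of
the component in direction `e`. -/
theorem abs_inner_le_stdDev_of_mem_ellipsoid [DecidableEq ι] (hZ : MemLp Z 2 μ)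
    {x : EuclideanSpace ℝ ι} (hx : x ∈ ellipsoid (covMatrix Z μ)) (e : EuclideanSpace ℝ ι) :
    |inner ℝ e x| ≤ stdDev (fun ω => inner ℝ e (Z ω)) μ := by
  obtain ⟨w, rfl, hw⟩ := hx
  have h1 := abs_covariance_le_stdDev_mul (memLp_inner_left hZ e) (memLp_inner_left hZ w)
  rw [inner_covMatrix hZ] at hw ⊢
  rw [covariance_self (memLp_inner_left hZ w).aemeasurable] at hw
  have h2 : stdDev (fun ω => inner ℝ w (Z ω)) μ ≤ 1 := Real.sqrt_le_one.2 hw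
  exact h1.trans (mul_le_of_le_one_right (stdDev_nonneg _) h2)

theorem trace_covMatrix (hZ : MemLp Z 2 μ) :
    (covMatrix Z μ).trace = ∫ ω, ‖Z ω - ∫ ω', Z ω' ∂μ‖ ^ 2 ∂μ := by
  have hZa : ∀ a, MemLp (fun ω => Z ω a) 2 μ := fun a => memLp_coord hZ a
  have hm : ∀ a, (∫ ω', Z ω' ∂μ) a = ∫ ω', Z ω' a ∂μ := fun a =>
    ((EuclideanSpace.proj (𝕜 := ℝ) a).integral_comp_comm (hZ.integrable one_le_two)).symm
  simp only [EuclideanSpace.real_norm_sq_eq, PiLp.sub_apply, hm]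
  have hi : ∀ a, Integrable (fun ω => (Z ω a - ∫ ω', Z ω' a ∂μ) ^ 2) μ := fun a =>
    ((hZa a).sub (memLp_const _)).integrable_sq
  rw [integral_finsetSum _ fun a _ => hi a]
  refine Finset.sum_congr rfl fun a _ => ?_
  rw [Matrix.diag_apply, covMatrix, Matrix.of_apply, covariance_self (hZa a).aemeasurable,
    variance_eq_integral (hZa a).aemeasurable]

theorem stdDev_inner_le (hZ : MemLp Z 2 μ) (e : EuclideanSpace ℝ ι) :
    stdDev (fun ω => inner ℝ e (Z ω)) μ ≤ ‖e‖ * Real.sqrt (covMatrix Z μ).trace := by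
  set m := ∫ ω', Z ω' ∂μ with hm
  have hW : MemLp (fun ω => Z ω - m) 2 μ := hZ.sub (memLp_const m)
  have h1 : stdDev (fun ω => inner ℝ e (Z ω)) μ = stdDev (fun ω => inner ℝ e (Z ω - m)) μ := by
    simp only [stdDev, inner_sub_right]
    rw [variance_sub_const (memLp_inner_left hZ e).aestronglyMeasurable]
  rw [h1, trace_covMatrix hZ, ← hm, ← Real.sqrt_sq (norm_nonneg e),
    ← Real.sqrt_mul (sq_nonneg _), ← integral_const_mul]
  refine (stdDev_le_sqrt_integral (memLp_inner_left hW e).aestronglyMeasurable).trans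
    (Real.sqrt_le_sqrt (integral_mono (memLp_inner_left hW e).integrable_sq
      ((hW.integrable_norm_pow two_ne_zero).const_mul _) fun ω => ?_))
  simp only [← mul_pow]
  exact sq_le_sq.2 (by
    rw [abs_of_nonneg (by positivity : 0 ≤ ‖e‖ * ‖Z ω - m‖)]; exact abs_real_inner_le_norm _ _)

end Covariance

/-- The second moment of a remainder that is quadratic near the origin and at most linear far away:
split at distance `s`. -/
theorem integral_sq_norm_le_of_quadratic_of_linear {E F : Type*} [NormedAddCommGroup E]
    [NormedAddCommGroup F] {Ω : Type*} [MeasurableSpace Ω] {μ : Measure Ω}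
    {W : Ω → E} {R : Ω → F} (hW : MemLp W 2 μ)
    (hR : AEStronglyMeasurable R μ) {K Λ s : ℝ}
    (h1 : ∀ ω, ‖R ω‖ ≤ K * ‖W ω‖ ^ 2) (h2 : ∀ ω, ‖R ω‖ ≤ Λ * ‖W ω‖) :
    ∫ ω, ‖R ω‖ ^ 2 ∂μ ≤
      K ^ 2 * s ^ 2 * ∫ ω, ‖W ω‖ ^ 2 ∂μ + Λ ^ 2 * ∫ ω in {ω | s < ‖W ω‖}, ‖W ω‖ ^ 2 ∂μ := by
  have hset : NullMeasurableSet {ω | s < ‖W ω‖} μ :=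
    nullMeasurableSet_lt aemeasurable_const hW.aestronglyMeasurable.norm.aemeasurable
  have hW2 : Integrable (fun ω => ‖W ω‖ ^ 2) μ := hW.integrable_norm_pow two_ne_zero
  have hRm : MemLp R 2 μ := hW.of_le_mul hR (Eventually.of_forall h2)
  rw [← integral_indicator₀ hset, ← integral_const_mul, ← integral_const_mul,
    ← integral_add (hW2.const_mul _) ((hW2.indicator₀ hset).const_mul _)]
  refine integral_mono (hRm.integrable_norm_pow two_ne_zero)
    ((hW2.const_mul _).add ((hW2.indicator₀ hset).const_mul _)) fun ω => ?_
  by_cases hω : s < ‖W ω‖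
  · have h3 := pow_le_pow_left₀ (norm_nonneg _) (h2 ω) 2
    have h4 : 0 ≤ K ^ 2 * s ^ 2 * ‖W ω‖ ^ 2 := by positivity
    simp only [Set.indicator, Set.mem_ofPred_eq, hω, if_true]
    linarith
  · have h3 := pow_le_pow_left₀ (norm_nonneg _) (h1 ω) 2
    have h4 : ‖W ω‖ ^ 2 ≤ s ^ 2 := pow_le_pow_left₀ (norm_nonneg _) (not_lt.1 hω) 2
    have h5 := mul_le_mul_of_nonneg_left h4 (by positivity : 0 ≤ K ^ 2 * ‖W ω‖ ^ 2)
    simp only [Set.indicator, Set.mem_ofPred_eq, hω, if_false]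
    nlinarith

/-! ### The linear symplectic width of a covariance ellipsoid -/

/-- A ball whose image lies between two parallel hyperplanes: `r ‖A† e‖` is the half-width of the
image in direction `e`. -/
theorem mul_norm_adjoint_le_of_abs_inner_le {E F : Type*} [NormedAddCommGroup E]
    [InnerProductSpace ℝ E] [FiniteDimensional ℝ E] [NormedAddCommGroup F] [InnerProductSpace ℝ F]
    [FiniteDimensional ℝ F] {A : E →ₗ[ℝ] F} {b e : F} {r a : ℝ} (hr : 0 ≤ r)
    (h : ∀ z ∈ Metric.closedBall (0 : E) r, |inner ℝ e (A z + b)| ≤ a) :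
    r * ‖A.adjoint e‖ ≤ a := by
  rcases eq_or_ne (A.adjoint e) 0 with h0 | h0
  · rw [h0, norm_zero, mul_zero]
    exact (abs_nonneg _).trans (h 0 (Metric.mem_closedBall_self hr))
  have hn : ‖A.adjoint e‖ ≠ 0 := norm_ne_zero_iff.2 h0
  have hz : ‖(r / ‖A.adjoint e‖) • A.adjoint e‖ = r := by
    rw [norm_smul, Real.norm_of_nonneg (by positivity), div_mul_cancel₀ _ hn]
  have hi : inner ℝ e (A ((r / ‖A.adjoint e‖) • A.adjoint e)) = r * ‖A.adjoint e‖ := by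
    rw [← LinearMap.adjoint_inner_left, real_inner_smul_right, real_inner_self_eq_norm_sq]
    field_simp
  have h1 := h ((r / ‖A.adjoint e‖) • A.adjoint e) (by simp [hz])
  have h2 := h (-((r / ‖A.adjoint e‖) • A.adjoint e)) (by rw [mem_closedBall_zero_iff, norm_neg, hz])
  rw [inner_add_right, hi] at h1
  rw [map_neg, inner_add_right, inner_neg_right, hi] at h2
  rw [abs_le] at h1 h2
  linarith [h1.2, h2.1]

namespace Phase

variable {n : ℕ}

theorem inner_symplJ_adjoint_toEuclideanLin {S : Matrix (Fin n ⊕ Fin n) (Fin n ⊕ Fin n) ℝ}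
    (hS : S ∈ Matrix.symplecticGroup (Fin n) ℝ) (e f : Phase n) :
    inner ℝ (symplJ n (S.toEuclideanLin.adjoint e)) (S.toEuclideanLin.adjoint f) =
      inner ℝ (symplJ n e) f := by
  have hJ : ∀ u : Phase n, symplJ n u = -(Matrix.J (Fin n) ℝ).toEuclideanLin u := fun u => by
    ext a
    cases a <;>
      simp [Matrix.J, Matrix.fromBlocks_mulVec, Matrix.toLpLin_apply, Matrix.neg_mulVec]
  rw [LinearMap.adjoint_inner_right, ← Matrix.toEuclideanLin_conjTranspose_eq_adjoint,
    Matrix.conjTranspose_eq_transpose_of_trivial]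
  congr 1
  rw [hJ, hJ, map_neg]
  congr 1
  conv_rhs => rw [← SymplecticGroup.mem_iff.1 hS, Matrix.toLpLin_mul_same, Matrix.toLpLin_mul_same]
  rfl

end Phase

/-- The uncertainty principle for the linear symplectic width, in directions `e` and `f`. -/
theorem covWidth_mul_abs_le {Ω : Type*} [MeasurableSpace Ω] {μ : Measure Ω}
    [IsProbabilityMeasure μ] {n : ℕ} {Z : Ω → Phase n} (hZ : MemLp Z 2 μ) (e f : Phase n) :
    covWidth Z μ * |inner ℝ (Phase.symplJ n e) f| ≤
      Real.pi * (stdDev (fun ω => inner ℝ e (Z ω)) μ * stdDev (fun ω => inner ℝ f (Z ω)) μ) := by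
  have hR : 0 ≤ Real.pi *
      (stdDev (fun ω => inner ℝ e (Z ω)) μ * stdDev (fun ω => inner ℝ f (Z ω)) μ) :=
    mul_nonneg Real.pi_pos.le (mul_nonneg (stdDev_nonneg _) (stdDev_nonneg _))
  rcases (abs_nonneg (inner ℝ (Phase.symplJ n e) f)).eq_or_lt with h0 | h0
  · rwa [← h0, mul_zero]
  rw [← le_div_iff₀ h0]
  refine Real.sSup_le ?_ (div_nonneg hR h0.le)
  rintro _ ⟨r, hr, rfl, S, hS, b, hSb⟩
  have h1 : ∀ e : Phase n, r * ‖S.toEuclideanLin.adjoint e‖ ≤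
      stdDev (fun ω => inner ℝ e (Z ω)) μ := fun e =>
    mul_norm_adjoint_le_of_abs_inner_le (b := b) hr.le fun z hz =>
      abs_inner_le_stdDev_of_mem_ellipsoid hZ (hSb ⟨z, hz, rfl⟩) e
  have h2 := mul_le_mul (h1 e) (h1 f) (by positivity) (stdDev_nonneg _)
  have h3 := Phase.abs_inner_symplJ_le (S.toEuclideanLin.adjoint e) (S.toEuclideanLin.adjoint f)
  rw [Phase.inner_symplJ_adjoint_toEuclideanLin hS] at h3
  rw [le_div_iff₀ h0, mul_assoc]
  refine mul_le_mul_of_nonneg_left (le_trans ?_ h2) Real.pi_pos.le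
  nlinarith [mul_le_mul_of_nonneg_left h3 (sq_nonneg r)]

theorem covWidth_nonneg {Ω : Type*} [MeasurableSpace Ω] {μ : Measure Ω} {n : ℕ}
    (Z : Ω → Phase n) : 0 ≤ covWidth Z μ := by
  refine Real.sSup_nonneg ?_
  rintro _ ⟨r, hr, rfl, -⟩
  positivity

/-! ### The uncertainty inequality for nearly linear symplectic maps -/

theorem norm_fderiv_sub_le_of_norm_iteratedFDeriv_two_le {E F : Type*} [NormedAddCommGroup E]
    [NormedSpace ℝ E] [NormedAddCommGroup F] [NormedSpace ℝ F] {ψ : E → F} {K : ℝ}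
    (hψ : ContDiff ℝ 2 ψ) (hK : ∀ z, ‖iteratedFDeriv ℝ 2 ψ z‖ ≤ K) (z m : E) :
    ‖fderiv ℝ ψ z - fderiv ℝ ψ m‖ ≤ K * ‖z - m‖ := by
  refine convex_univ.norm_image_sub_le_of_norm_fderiv_le (𝕜 := ℝ) (fun x _ =>
    (hψ.fderiv_right (m := 1) (by norm_num)).differentiable (by norm_num) x) (fun x _ => ?_)
    (Set.mem_univ m) (Set.mem_univ z)
  rw [← norm_iteratedFDeriv_one, norm_iteratedFDeriv_fderiv]
  exact hK x

section Remainder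

variable {Ω : Type*} [MeasurableSpace Ω] {μ : Measure Ω} [IsProbabilityMeasure μ]

theorem memLp_comp_of_norm_fderiv_le {E F : Type*} [NormedAddCommGroup E]
    [NormedSpace ℝ E] [NormedAddCommGroup F] [NormedSpace ℝ F] {ψ : E → F} {Λ : ℝ}
    (hψ : Differentiable ℝ ψ) (hΛ : ∀ z, ‖fderiv ℝ ψ z‖ ≤ Λ) {Z : Ω → E} (hZ : MemLp Z 2 μ) :
    MemLp (fun ω => ψ (Z ω)) 2 μ := by
  have h1 : MemLp (fun ω => ψ (Z ω) - ψ 0) 2 μ := by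
    refine hZ.of_le_mul ((hψ.continuous.comp_aestronglyMeasurable hZ.aestronglyMeasurable).sub
      aestronglyMeasurable_const) (c := Λ) (Eventually.of_forall fun ω => ?_)
    simpa using convex_univ.norm_image_sub_le_of_norm_fderiv_le (𝕜 := ℝ) (fun x _ => hψ x)
      (fun x _ => hΛ x) (Set.mem_univ 0) (Set.mem_univ (Z ω))
  convert h1.add (memLp_const (ψ 0)) using 1
  ext ω
  simp

/-- Replacing a map by its linearization at the mean changes the standard deviation of the component
in direction `e` by at most the root mean square of the Taylor remainder, which is small compared with
the standard deviation of `Z` if `Z` is concentrated and has light tails. -/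
theorem stdDev_inner_adjoint_fderiv_le {n : ℕ} {ψ : Phase n → Phase n} {Λ K s : ℝ}
    (hψ : ContDiff ℝ 2 ψ) (hΛ : ∀ z, ‖fderiv ℝ ψ z‖ ≤ Λ)
    (hK : ∀ z, ‖iteratedFDeriv ℝ 2 ψ z‖ ≤ K) {Z : Ω → Phase n} (hZ : MemLp Z 2 μ) {m : Phase n}
    (hm : m = ∫ ω, Z ω ∂μ) {e : Phase n} (he : ‖e‖ ≤ 1) :
    stdDev (fun ω => inner ℝ ((fderiv ℝ ψ m).adjoint e) (Z ω)) μ ≤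
      stdDev (fun ω => inner ℝ e (ψ (Z ω))) μ +
        Real.sqrt (K ^ 2 * s ^ 2 * (covMatrix Z μ).trace +
          (2 * Λ) ^ 2 * ∫ ω in {ω | s < ‖Z ω - m‖}, ‖Z ω - m‖ ^ 2 ∂μ) := by
  have hd := hψ.differentiable (by norm_num)
  have hK0 : 0 ≤ K := (norm_nonneg _).trans (hK 0)
  set S := fderiv ℝ ψ m with hS
  set R : Ω → Phase n := fun ω => ψ (Z ω) - ψ m - S (Z ω - m) with hR
  have hW : MemLp (fun ω => Z ω - m) 2 μ := hZ.sub (memLp_const m)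
  have hψZ := memLp_comp_of_norm_fderiv_le hd hΛ hZ
  have hRm : MemLp R 2 μ := (hψZ.sub (memLp_const _)).sub (S.comp_memLp' hW)
  have h1 : ∀ ω, ‖R ω‖ ≤ K * ‖Z ω - m‖ ^ 2 := fun ω =>
    norm_sub_sub_le_sq_of_norm_fderiv_sub_le (fun z => (hd z).hasFDerivAt) hK0
      (fun z => norm_fderiv_sub_le_of_norm_iteratedFDeriv_two_le hψ hK z m) (Z ω)
  have h2 : ∀ ω, ‖R ω‖ ≤ 2 * Λ * ‖Z ω - m‖ := fun ω => by
    have ha := convex_univ.norm_image_sub_le_of_norm_fderiv_le (𝕜 := ℝ) (fun x _ => hd x)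
      (fun x _ => hΛ x) (Set.mem_univ m) (Set.mem_univ (Z ω))
    have hb := S.le_of_opNorm_le (hΛ m) (Z ω - m)
    have hc := norm_sub_le (ψ (Z ω) - ψ m) (S (Z ω - m))
    simp only [hR]
    linarith
  have h3 := integral_sq_norm_le_of_quadratic_of_linear (s := s) hW hRm.aestronglyMeasurable h1 h2
  have htr : (covMatrix Z μ).trace = ∫ ω, ‖Z ω - m‖ ^ 2 ∂μ := by rw [trace_covMatrix hZ, hm]
  rw [← htr] at h3
  have hN : MemLp (fun ω => inner ℝ (-e) (R ω)) 2 μ := memLp_inner_left hRm (-e)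
  have h4 : stdDev (fun ω => inner ℝ (-e) (R ω)) μ ≤ Real.sqrt (∫ ω, ‖R ω‖ ^ 2 ∂μ) := by
    refine (stdDev_le_sqrt_integral hN.aestronglyMeasurable).trans
      (Real.sqrt_le_sqrt (integral_mono hN.integrable_sq
        (hRm.integrable_norm_pow two_ne_zero) fun ω => ?_))
    have ha : |inner ℝ (-e) (R ω)| ≤ ‖R ω‖ := (abs_real_inner_le_norm _ _).trans
      (by rw [norm_neg]; exact mul_le_of_le_one_left (norm_nonneg _) he)
    exact sq_le_sq.2 (by rwa [abs_of_nonneg (norm_nonneg _)])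
  have h5 : stdDev (fun ω => inner ℝ (S.adjoint e) (Z ω)) μ =
      stdDev ((fun ω => inner ℝ e (ψ (Z ω))) + fun ω => inner ℝ (-e) (R ω)) μ := by
    have : ((fun ω => inner ℝ e (ψ (Z ω))) + fun ω => inner ℝ (-e) (R ω)) =
        fun ω => inner ℝ (S.adjoint e) (Z ω) + (inner ℝ e (ψ m) - inner ℝ e (S m)) := by
      ext ω
      simp only [Pi.add_apply, hR, ContinuousLinearMap.adjoint_inner_left, inner_neg_left,
        inner_sub_right, map_sub]
      ring
    rw [this, stdDev, stdDev,
      variance_add_const (memLp_inner_left hZ (S.adjoint e)).aestronglyMeasurable]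
  rw [h5]
  exact (stdDev_add_le (memLp_inner_left hψZ e) hN).trans
    (add_le_add_right (h4.trans (Real.sqrt_le_sqrt h3)) _)

end Remainder

/-- The arithmetic of the loss: if two numbers of size at most `Λ σ` have product at least `κ σ²`, an
error of `κ σ / (10 Λ)` is at most a tenth of each, and `0.9² ≥ 1 / √2`. -/
theorem inv_sqrt_two_mul_le_mul {a b x y q κ Λ σ : ℝ} (ha : 0 ≤ a) (hb : 0 ≤ b)
    (hΛ : 0 < Λ) (hσ : 0 ≤ σ) (hq : 0 < q) (hκ : κ * σ ^ 2 ≤ q) (hab : q ≤ a * b)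
    (haΛ : a ≤ Λ * σ) (hbΛ : b ≤ Λ * σ) (hax : a ≤ x + κ / (10 * Λ) * σ)
    (hby : b ≤ y + κ / (10 * Λ) * σ) : 1 / Real.sqrt 2 * q ≤ x * y := by
  have hσ0 : 0 < σ := by
    rcases hσ.eq_or_lt with h | h
    -- for `σ = 0` both numbers vanish, and their product could not be at least `q`
    · rw [← h, mul_zero] at haΛ hbΛ
      nlinarith [le_antisymm haΛ ha]
    · exact h
  have key : ∀ {a b : ℝ}, 0 ≤ a → b ≤ Λ * σ → q ≤ a * b → κ / (10 * Λ) * σ ≤ a / 10 := by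
    intro a b ha hb h
    have h1 : κ * σ * σ ≤ a * Λ * σ := by nlinarith [mul_le_mul_of_nonneg_left hb ha]
    have h2 := le_of_mul_le_mul_right h1 hσ0
    rw [div_mul_eq_mul_div, div_le_div_iff₀ (by positivity) (by norm_num)]
    linarith
  have hx : 9 / 10 * a ≤ x := by linarith [key ha hbΛ hab]
  have hy : 9 / 10 * b ≤ y := by linarith [key hb haΛ (by linarith : q ≤ b * a)]
  have h2 : 1 / Real.sqrt 2 ≤ 81 / 100 := by
    rw [div_le_div_iff₀ (by positivity) (by norm_num)]
    have : (1.3 : ℝ) ≤ Real.sqrt 2 := Real.le_sqrt_of_sq_le (by norm_num)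
    linarith
  calc 1 / Real.sqrt 2 * q ≤ 81 / 100 * (a * b) := mul_le_mul h2 hab hq.le (by norm_num)
    _ = (9 / 10 * a) * (9 / 10 * b) := by ring
    _ ≤ x * y := mul_le_mul hx hy (by positivity) ((by positivity : 0 ≤ 9 / 10 * a).trans hx)

/-- The uncertainty inequality for the image of a concentrated random vector under a symplectic map
with bounded derivatives of orders one and two. The number `δ` depends only on the bounds. -/
theorem exists_uncertainty_of_symplectic (n : ℕ) (K : ℝ) {Λ c : ℝ} (hΛ : 0 < Λ) (hc : 0 < c)
    {τ : ℝ → ℝ} (hτ : Tendsto τ atTop (𝓝 0)) :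
    ∃ δ : ℝ, 0 < δ ∧ ∀ ψ : Phase n → Phase n, ContDiff ℝ 2 ψ →
      (∀ z, ‖fderiv ℝ ψ z‖ ≤ Λ) → (∀ z, ‖iteratedFDeriv ℝ 2 ψ z‖ ≤ K) →
      (∀ z u w, inner ℝ (Phase.symplJ n (fderiv ℝ ψ z u)) (fderiv ℝ ψ z w) =
        inner ℝ (Phase.symplJ n u) w) →
      ∀ (Ω : Type*) [MeasurableSpace Ω] (μ : Measure Ω) [IsProbabilityMeasure μ] (Z : Ω → Phase n),
        HasShape Z μ c τ → (∀ a, stdDev (fun ω => Z ω a) μ < δ) → ∀ α : Fin n,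
        1 / Real.sqrt 2 * (covWidth Z μ / Real.pi) ≤
          stdDev (fun ω => ψ (Z ω) (Sum.inl α)) μ * stdDev (fun ω => ψ (Z ω) (Sum.inr α)) μ := by
  set κ := c / Real.pi with hκdef
  have hκ : 0 < κ := div_pos hc Real.pi_pos
  set ε := κ / (10 * Λ) with hεdef
  have hε : 0 < ε := by positivity
  obtain ⟨ρ, hρ0, hρ⟩ : ∃ ρ, 0 < ρ ∧ τ ρ < ε ^ 2 / (8 * Λ ^ 2) :=
    ((eventually_gt_atTop 0).and (hτ.eventually_lt_const (by positivity))).exists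
  set δ := Real.sqrt (ε ^ 2 / (4 * (K ^ 2 * ρ ^ 2 * n + 1))) with hδdef
  have hδ2 : δ ^ 2 = ε ^ 2 / (4 * (K ^ 2 * ρ ^ 2 * n + 1)) := Real.sq_sqrt (by positivity)
  refine ⟨δ, Real.sqrt_pos.2 (by positivity), ?_⟩
  intro ψ hψ hψΛ hψK hsymp Ω _ μ _ Z hshape hδ α
  have hZ := hshape.memLp
  rcases (covWidth_nonneg (μ := μ) Z).eq_or_lt with h0 | h0
  · rw [← h0, zero_div, mul_zero]
    exact mul_nonneg (stdDev_nonneg _) (stdDev_nonneg _)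
  set m := ∫ ω, Z ω ∂μ with hm
  set σ := Real.sqrt (covMatrix Z μ).trace with hσ
  have htr0 : 0 ≤ (covMatrix Z μ).trace := by
    rw [trace_covMatrix hZ]
    exact integral_nonneg fun ω => sq_nonneg _
  have hσ2 : σ ^ 2 = (covMatrix Z μ).trace := Real.sq_sqrt htr0
  have htr : (covMatrix Z μ).trace ≤ 2 * n * δ ^ 2 := by
    have h1 : (covMatrix Z μ).trace ≤ ∑ _a : Fin n ⊕ Fin n, δ ^ 2 := by
      refine Finset.sum_le_sum fun a _ => ?_
      rw [Matrix.diag_apply, covMatrix, Matrix.of_apply,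
        covariance_self (memLp_coord hZ a).aemeasurable, ← stdDev_sq]
      exact pow_le_pow_left₀ (stdDev_nonneg _) (hδ a).le 2
    simp only [Finset.sum_const, Finset.card_univ, Fintype.card_sum, Fintype.card_fin,
      nsmul_eq_mul, Nat.cast_add] at h1
    linarith
  -- the Taylor remainder has root mean square at most `ε σ`
  have herr : Real.sqrt (K ^ 2 * (ρ * σ) ^ 2 * (covMatrix Z μ).trace +
      (2 * Λ) ^ 2 * ∫ ω in {ω | ρ * σ < ‖Z ω - m‖}, ‖Z ω - m‖ ^ 2 ∂μ) ≤ ε * σ := by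
    refine Real.sqrt_le_iff.2 ⟨by positivity, ?_⟩
    have h1 : (2 * Λ) ^ 2 * ∫ ω in {ω | ρ * σ < ‖Z ω - m‖}, ‖Z ω - m‖ ^ 2 ∂μ ≤
        ε ^ 2 / 2 * σ ^ 2 := by
      have ha := hshape.tail ρ hρ0
      rw [← hσ2] at ha
      have hb : (2 * Λ) ^ 2 * τ ρ ≤ ε ^ 2 / 2 := by
        rw [lt_div_iff₀ (by positivity)] at hρ
        nlinarith
      rw [Real.sqrt_sq (Real.sqrt_nonneg _)] at ha
      calc _ ≤ (2 * Λ) ^ 2 * (τ ρ * σ ^ 2) := mul_le_mul_of_nonneg_left ha (sq_nonneg _)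
        _ = (2 * Λ) ^ 2 * τ ρ * σ ^ 2 := by ring
        _ ≤ _ := mul_le_mul_of_nonneg_right hb (sq_nonneg _)
    have h2 : K ^ 2 * (ρ * σ) ^ 2 * (covMatrix Z μ).trace ≤ ε ^ 2 / 2 * σ ^ 2 := by
      rw [← hσ2] at htr ⊢
      rw [mul_pow]
      refine mul_le_mul_of_nonneg_right ?_ (sq_nonneg _)
      have ha : K ^ 2 * ρ ^ 2 * σ ^ 2 ≤ K ^ 2 * ρ ^ 2 * (2 * n * δ ^ 2) := by gcongr
      have hb : K ^ 2 * ρ ^ 2 * (2 * n * δ ^ 2) ≤ ε ^ 2 / 2 := by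
        have hpos : 0 ≤ K ^ 2 * ρ ^ 2 * n := by positivity
        rw [hδ2, ← mul_assoc, mul_div_assoc', div_le_div_iff₀ (by positivity) (by norm_num)]
        nlinarith [mul_nonneg hpos (sq_nonneg ε), sq_nonneg ε]
      linarith
    rw [mul_pow]
    linarith
  set S := fderiv ℝ ψ m with hS
  set e : Phase n := EuclideanSpace.single (Sum.inl α) 1 with he
  set f : Phase n := EuclideanSpace.single (Sum.inr α) 1 with hf
  have hen : ‖e‖ = 1 := by simp [he]
  have hfn : ‖f‖ = 1 := by simp [hf]
  have hSn : ∀ e : Phase n, ‖e‖ = 1 → stdDev (fun ω => inner ℝ (S.adjoint e) (Z ω)) μ ≤ Λ * σ :=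
    fun e he => (stdDev_inner_le hZ _).trans (mul_le_mul_of_nonneg_right
      (by
        have := S.adjoint.le_opNorm e
        rw [he, mul_one, LinearIsometryEquiv.norm_map] at this
        exact this.trans (hψΛ m)) (Real.sqrt_nonneg _))
  have hlin : ∀ e : Phase n, ‖e‖ = 1 → stdDev (fun ω => inner ℝ (S.adjoint e) (Z ω)) μ ≤
      stdDev (fun ω => inner ℝ e (ψ (Z ω))) μ + κ / (10 * Λ) * σ := fun e he =>
    (stdDev_inner_adjoint_fderiv_le hψ hψΛ hψK hZ hm he.le (s := ρ * σ)).trans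
      (add_le_add_right herr _)
  have hω : |inner ℝ (Phase.symplJ n (S.adjoint e)) (S.adjoint f)| = 1 := by
    rw [Phase.inner_symplJ_adjoint (hsymp m)]
    simp [he, hf, EuclideanSpace.inner_single_right]
  have hwidth := covWidth_mul_abs_le hZ (S.adjoint e) (S.adjoint f)
  rw [hω, mul_one] at hwidth
  have hee : ∀ ω, inner ℝ e (ψ (Z ω)) = ψ (Z ω) (Sum.inl α) := fun ω => by
    simp [he, EuclideanSpace.inner_single_left]
  have hff : ∀ ω, inner ℝ f (ψ (Z ω)) = ψ (Z ω) (Sum.inr α) := fun ω => by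
    simp [hf, EuclideanSpace.inner_single_left]
  simp only [← hee, ← hff]
  refine inv_sqrt_two_mul_le_mul (κ := κ) (stdDev_nonneg _) (stdDev_nonneg _) hΛ
    (Real.sqrt_nonneg _) (div_pos h0 Real.pi_pos) ?_ ?_ (hSn e hen) (hSn f hfn) (hlin e hen)
    (hlin f hfn)
  · rw [hκdef, div_mul_eq_mul_div]
    refine div_le_div_of_nonneg_right ?_ Real.pi_pos.le
    rw [← hσ, hσ2]
    exact hshape.width h0
  · rw [div_le_iff₀ Real.pi_pos]
    linarith

end

theorem mainTheorem2 (G : RegularizedGame) (i : Fin 2) (v : G.E (1 - i)) (t₀ : ℝ) (ht₀ : 0 < t₀)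
    (φ : ℝ → Phase (G.n i) → Phase (G.n i)) (hφ : IsHamiltonianFlow (G.hamiltonian i v) t₀ φ)
    (I : Set ℝ) (hI : I ⊆ Set.Ioi t₀) (K : ℝ)
    (hsmooth : ∀ t ∈ I, ContDiff ℝ 2 (φ t))
    (hK : ∀ t ∈ I, ∀ z, ‖iteratedFDeriv ℝ 2 (φ t) z‖ ≤ K)
    (hI' : BddAbove I ∨ ∀ t ∈ I, ∀ z, ‖fderiv ℝ (φ t) z‖ ≤ K)
    (c : ℝ) (hc : 0 < c) (τ : ℝ → ℝ) (hτ : Tendsto τ atTop (𝓝 0)) :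
    ∃ δ : ℝ, 0 < δ ∧
      ∀ (Ω : Type*) [MeasurableSpace Ω] (μ : Measure Ω) [IsProbabilityMeasure μ]
        (X y : ℝ → Ω → G.E i),
        (∀ᵐ ω ∂μ, G.IsFTRL i v t₀ (fun t => X t ω) (fun t => y t ω)) →
        HasShape (fun ω => Phase.mk (X t₀ ω) (y t₀ ω)) μ c τ →
        (∀ α, stdDev (fun ω => X t₀ ω α) μ < δ ∧ stdDev (fun ω => y t₀ ω α) μ < δ) →
        ∀ t ∈ I, ∀ α : Fin (G.n i),
          MemLp (fun ω => X t ω α) 2 μ ∧ MemLp (fun ω => y t ω α) 2 μ ∧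
          1 / Real.sqrt 2 * (covWidth (fun ω => Phase.mk (X t₀ ω) (y t₀ ω)) μ / Real.pi) ≤
            stdDev (fun ω => X t ω α) μ * stdDev (fun ω => y t ω α) μ := by
  obtain ⟨L, hL⟩ := G.exists_lipschitzWith_hamiltonianField i v
  obtain ⟨L', hL'⟩ := G.exists_lipschitzWith_hamiltonianGradient i v
  -- on bounded time sets Gronwall's inequality bounds the first derivative
  obtain ⟨Λ, hΛ0, hΛ⟩ : ∃ Λ : ℝ, 0 < Λ ∧ ∀ t ∈ I, ∀ z, ‖fderiv ℝ (φ t) z‖ ≤ Λ := by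
    rcases hI' with ⟨T, hT⟩ | h
    · refine ⟨Real.exp (L * (T - t₀)), Real.exp_pos _, fun t ht z => ?_⟩
      refine (norm_fderiv_le_of_lip' ℝ (Real.exp_pos _).le (Eventually.of_forall fun q =>
        norm_flow_sub_le hL (fun z => (hφ z).1) (fun z => (hφ z).2) (le_of_lt (hI ht)) z q)).trans ?_
      gcongr
      exact hT ht
    · exact ⟨max K 1, lt_max_of_lt_right one_pos, fun t ht z => (h t ht z).trans (le_max_left _ _)⟩
  obtain ⟨δ, hδ0, hδ⟩ := exists_uncertainty_of_symplectic (G.n i) K hΛ0 hc hτ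
  refine ⟨δ, hδ0, ?_⟩
  intro Ω _ μ _ X y hftrl hshape hstd t ht α
  have ht' : t₀ ≤ t := le_of_lt (hI ht)
  have hsymp := fun z u w => symplecticForm_fderiv_flow (J := Phase.symplJ (G.n i))
    Phase.inner_symplJ_symplJ Phase.inner_symplJ_left (G.hasFDerivAt_hamiltonian i v) hL'
    (fun z => (hφ z).1) (fun z t ht => by rw [← G.hamiltonianField_eq]; exact (hφ z).2 t ht) ht'
    (hsmooth t ht) z u w
  have hmain := hδ (φ t) (hsmooth t ht) (hΛ t ht) (hK t ht) hsymp Ω μ _ hshape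
    (fun a => by cases a with
      | inl a => exact (hstd a).1
      | inr a => exact (hstd a).2) α
  have hflow : ∀ᵐ ω ∂μ, Phase.mk (X t ω) (y t ω) = φ t (Phase.mk (X t₀ ω) (y t₀ ω)) := by
    filter_upwards [hftrl] with ω hω
    exact hω.mk_eq_flow hφ ht'
  have hX : (fun ω => φ t (Phase.mk (X t₀ ω) (y t₀ ω)) (Sum.inl α)) =ᵐ[μ] fun ω => X t ω α := by
    filter_upwards [hflow] with ω hω
    rw [← hω, Phase.mk_inl]
  have hy : (fun ω => φ t (Phase.mk (X t₀ ω) (y t₀ ω)) (Sum.inr α)) =ᵐ[μ] fun ω => y t ω α := by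
    filter_upwards [hflow] with ω hω
    rw [← hω, Phase.mk_inr]
  have hφZ := memLp_comp_of_norm_fderiv_le ((hsmooth t ht).differentiable (by norm_num)) (hΛ t ht)
    hshape.memLp
  refine ⟨(memLp_coord hφZ _).ae_eq hX, (memLp_coord hφZ _).ae_eq hy, ?_⟩
  rwa [stdDev, stdDev, variance_congr hX, variance_congr hy] at hmain
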